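/- Let $n\ge 1$ and $a_0<0<a_1<\dots<a_n$, and let $x=x(s)$, $s\in\mathbb R$, be a geodesic, parametrised by arc length, on the one-sheeted hyperboloid $$\frac{x_0^2}{a_0}+\frac{x_1^2}{a_1}+\dots+\frac{x_n^2}{a_n}=1$$ in Euclidean space $\mathbb R^{n+1}$; put $y=x'(s)$. Then the Uhlenbeck–Devaney function $$F_0=y_0^2+\sum_{j=1}^n\frac{(x_0y_j-x_jy_0)^2}{a_0-a_j}$$ is constant along the geodesic, and the following holds. 1. The geodesic crosses the neck ellipsoid $\{x_0=0\}$ (that is, at some moment $x_0$ vanishes and changes sign) if and only if $F_0>0$; in this case it comes from one of the two infinities $x_0\to\pm\infty$ of the hyperboloid and goes to the other one. 2. If $F_0<0$, the geodesic is reflected back: either $x_0(s)>0$ for all $s$ and $x_0(s)\to+\infty$ both as $s\to+\infty$ and as $s\to-\infty$, or $x_0(s)<0$ for all $s$ and $x_0(s)\to-\infty$ both as $s\to+\infty$ and as $s\to-\infty$. 3. If $F_0=0$, then either $x$ is itself a geodesic on the neck ellipsoid, or, for one choice of the direction of the parameter $s$, $|x_0(s)|\to\infty$ as $s\to-\infty$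 and $x$ exponentially approaches a geodesic on the neck ellipsoid as $s\to+\infty$: there are an arc-length parametrised geodesic $\gamma$ on the neck ellipsoid $\{x_0=0,\ \sum_{j\ge1}x_j^2/a_j=1\}$ and constants $C$ and $\kappa>0$ with $|x(s)-\gamma(s)|\le Ce^{-\kappa s}$ for all $s\ge0$. -/

import Mathlib

open Filter

noncomputable section

namespace HyperboloidGeodesics

/-- A geodesic in natural parameter `s ∈ ℝ` on the quadric `∑ x_k² / a_k = 1` in Euclidean `ℝ^m`:
a `C²` curve on the quadric, of unit speed, whose acceleration is normal to the quadric, that is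
`x'' = - λ B x` with `B = diag (1 / a_k)` and a scalar multiplier `λ(s)`. -/
structure IsGeodesic {m : ℕ} (a : Fin m → ℝ) (x : ℝ → EuclideanSpace ℝ (Fin m)) : Prop where
  contDiff : ContDiff ℝ 2 x
  mem_quadric : ∀ s, ∑ k, (x s k) ^ 2 / a k = 1
  unit_speed : ∀ s, ‖deriv x s‖ = 1
  normal_acceleration : ∃ lam : ℝ → ℝ, ∀ s k, deriv (deriv x) s k = -lam s * (x s k / a k)

/-- The Uhlenbeck-Devaney function `F_k (x, y)`. -/
def uhlenbeckDevaney {m : ℕ} (a : Fin m → ℝ) (k : Fin m) (x y : EuclideanSpace ℝ (Fin m)) : ℝ :=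
  (y k) ^ 2 + ∑ j ∈ Finset.univ.erase k, (x k * y j - x j * y k) ^ 2 / (a k - a j)

/-- The inclusion of the hyperplane `x_0 = 0` into `ℝ^(n+1)`. -/
def hyperplaneIncl {n : ℕ} (v : EuclideanSpace ℝ (Fin n)) : EuclideanSpace ℝ (Fin (n + 1)) :=
  WithLp.toLp 2 (Fin.cons 0 v.ofLp)

/-- A geodesic on the neck ellipsoid `x_0 = 0`, `∑_{j ≥ 1} x_j² / a_j = 1`, as a curve in
`ℝ^(n+1)`. -/
def IsNeckGeodesic {n : ℕ} (a : Fin (n + 1) → ℝ)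
    (γ : ℝ → EuclideanSpace ℝ (Fin (n + 1))) : Prop :=
  ∃ g : ℝ → EuclideanSpace ℝ (Fin n),
    IsGeodesic (fun j => a j.succ) g ∧ ∀ s, γ s = hyperplaneIncl (g s)

/-- The curve crosses the neck `x_0 = 0`: at some parameter value it passes from one (open) side of
the hyperplane `x_0 = 0` to the other. -/
def CrossesNeck {n : ℕ} (x : ℝ → EuclideanSpace ℝ (Fin (n + 1))) : Prop :=
  ∃ s₀ : ℝ, x s₀ 0 = 0 ∧
    (((∀ᶠ s in nhdsWithin s₀ (Set.Iio s₀), x s 0 < 0) ∧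
        ∀ᶠ s in nhdsWithin s₀ (Set.Ioi s₀), 0 < x s 0) ∨
      ((∀ᶠ s in nhdsWithin s₀ (Set.Iio s₀), 0 < x s 0) ∧
        ∀ᶠ s in nhdsWithin s₀ (Set.Ioi s₀), x s 0 < 0))

/-- The curve comes from one of the two infinities `x_0 → ±∞` and goes to the other one. -/
def PassesThrough {n : ℕ} (x : ℝ → EuclideanSpace ℝ (Fin (n + 1))) : Prop :=
  (Tendsto (fun s => x s 0) atBot atBot ∧ Tendsto (fun s => x s 0) atTop atTop) ∨
    (Tendsto (fun s => x s 0) atBot atTop ∧ Tendsto (fun s => x s 0) atTop atBot)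

/-- The curve comes from one of the two infinities `x_0 → ±∞`, stays on that side of the neck and
goes back to the same infinity. -/
def IsReflected {n : ℕ} (x : ℝ → EuclideanSpace ℝ (Fin (n + 1))) : Prop :=
  ((∀ s, 0 < x s 0) ∧
      Tendsto (fun s => x s 0) atBot atTop ∧ Tendsto (fun s => x s 0) atTop atTop) ∨
    ((∀ s, x s 0 < 0) ∧
      Tendsto (fun s => x s 0) atBot atBot ∧ Tendsto (fun s => x s 0) atTop atBot)

/-- As `s → +∞`, the point `x s` approaches the point `γ s` of some geodesic `γ` on the neck
ellipsoid, with an exponentially small distance. -/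
def ApproachesNeckGeodesic {n : ℕ} (a : Fin (n + 1) → ℝ)
    (x : ℝ → EuclideanSpace ℝ (Fin (n + 1))) : Prop :=
  ∃ γ : ℝ → EuclideanSpace ℝ (Fin (n + 1)), IsNeckGeodesic a γ ∧
    ∃ C κ : ℝ, 0 < κ ∧ ∀ s : ℝ, 0 ≤ s → dist (x s) (γ s) ≤ C * Real.exp (-κ * s)

end HyperboloidGeodesics

end

/-! Write α = -a₀, w_j = x₀Y_j - X_jy₀ and N = |Bx|². Differentiating the quadric twice gives λN =
(By, y), and F₀ = y₀² - ∑ w_j²/(a_j + α) is a first integral. The same sum with weights 1/a_j equals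
x₀²λN + y₀². Since 1/a_j = (1 + α/a_j)/(a_j + α), for c ≤ a_j ≤ C this yields (α/C)y₀² - (1 + α/C)F₀
≤ x₀²λN ≤ (α/c)y₀² - (1 + α/c)F₀ (`le_curvature`, `curvature_le_of_le`), while x₀'' = λx₀/α.

If F₀ > 0, then y₀² ≥ F₀, so x₀ is strictly monotone with slope bounded away from zero.

If F₀ < 0, then x₀ cannot vanish, because on the neck F₀ = y₀²(1 - ∑ X_j²/(a_j + α)) ≥ 0. The lower
bound makes |x₀| convex and drives it to infinity in both directions.

If F₀ = 0, then |y₀| ≤ K|x₀|, so a single zero of x₀ makes it vanish identically. Otherwise y₀ has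
no zero either and, up to reflection and time reversal, x₀ > 0 > y₀. Joachimsthal's integral λN² is
then a positive constant, and the upper bound gives -y₀ ≥ κx₀ for s ≥ 0: exponential decay.

The limit geodesic is explicit. The tangent line at x meets x₀ = 0 in a point p, and F₀ = 0 says
precisely that p lies on the focal ellipsoid ∑ p_j²/(a_j + α) = 1. A suitable tangent line from p
touches the neck ellipsoid at a point γ, and γ runs along a geodesic: γ' is parallel to p - γ, and
(p - γ)' stays in the span of p - γ and the normal at γ (`hasDerivAt_contactElement`). Both |X - γ|
and the deviation of the speed of γ from 1 are O(x₀²), so the arc length of γ is s + L up to an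
exponentially small error. -/

namespace HyperboloidGeodesics

open scoped Topology NNReal Manifold ContDiff

variable {n : ℕ}

/-! ### Completeness of the geodesic flow on an ellipsoid -/

/-- A bounded globally Lipschitz vector field has complete integral curves. -/
theorem exists_global_integralCurve {E : Type*} [NormedAddCommGroup E] [NormedSpace ℝ E]
    [CompleteSpace E] {W : E → E} {K : ℝ≥0} (hW : LipschitzWith K W) {M : ℝ≥0}
    (hM : ∀ z, ‖W z‖ ≤ M) (z₀ : E) :
    ∃ f : ℝ → E, f 0 = z₀ ∧ ∀ t, HasDerivAt f (W (f t)) t := by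
  have key : ∀ N : ℕ, ∃ f : ℝ → E, f 0 = z₀ ∧ ∀ t ∈ Set.Ioo (-((N : ℝ) + 1)) (N + 1),
      HasDerivAt f (W (f t)) t := by
    intro N
    have hN : (0 : ℝ) ≤ N := N.cast_nonneg
    have h0 : (0 : ℝ) ∈ Set.Icc (-((N : ℝ) + 1)) (N + 1) := ⟨by linarith, by linarith⟩
    -- At speed at most `M` a solution travels at most `M * (N + 1)` in time `N + 1`, so this ball
    -- contains it on the whole interval.
    have hPL : IsPicardLindelof (fun _ : ℝ => W) (tmin := -((N : ℝ) + 1)) (tmax := N + 1)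
        ⟨0, h0⟩ z₀ (M * (N + 1)) 0 M K := by
      refine ⟨fun t _ => hW.lipschitzOnWith, fun z _ => continuousOn_const, fun t _ z _ => hM z, ?_⟩
      simp
    obtain ⟨f, hf0, hf⟩ := hPL.exists_eq_forall_mem_Icc_hasDerivWithinAt₀
    exact ⟨f, hf0, fun t ht => (hf t (Set.Ioo_subset_Icc_self ht)).hasDerivAt
      (Icc_mem_nhds ht.1 ht.2)⟩
  choose f hf0 hf using key
  have agree : ∀ N N' : ℕ, N ≤ N' → Set.EqOn (f N) (f N')
      (Set.Ioo (-((N : ℝ) + 1)) (N + 1)) := by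
    intro N N' h
    have hN : (0 : ℝ) ≤ N := N.cast_nonneg
    have h' : (N : ℝ) ≤ N' := by exact_mod_cast h
    refine ODE_solution_unique_of_mem_Ioo (v := fun _ => W) (s := fun _ => Set.univ) (K := K)
      (t₀ := 0) (fun t _ => hW.lipschitzOnWith) ⟨by linarith, by linarith⟩
      (fun t ht => ⟨hf N t ht, trivial⟩)
      (fun t ht => ⟨hf N' t ⟨by linarith [ht.1], by linarith [ht.2]⟩, trivial⟩)
      (by rw [hf0, hf0])
  -- Near `t` the index jumps, but by `agree` all solutions whose interval contains `t` coincide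
  -- there.
  refine ⟨fun t => f ⌈|t|⌉₊ t, hf0 _, fun t => ?_⟩
  have hcongr : ∀ N : ℕ, ∀ u : ℝ, |u| < N + 1 → f ⌈|u|⌉₊ u = f N u := by
    intro N u hu
    rcases le_total ⌈|u|⌉₊ N with h | h
    · refine agree _ _ h (abs_lt.1 ?_)
      linarith [Nat.le_ceil |u|]
    · exact (agree _ _ h (abs_lt.1 hu)).symm
  have ht : |t| < (⌈|t|⌉₊ : ℝ) + 1 := by linarith [Nat.le_ceil |t|]
  refine (hf _ t (abs_lt.1 ht)).congr_of_eventuallyEq ?_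
  have : ∀ᶠ u in 𝓝 t, |u| < (⌈|t|⌉₊ : ℝ) + 1 := continuous_abs.continuousAt.eventually_lt_const ht
  filter_upwards [this] with u hu using hcongr _ u hu

/-- Near a compact set, a `C¹` vector field can be cut off to a bounded Lipschitz one. -/
theorem exists_lipschitz_cutoff {E : Type*} [NormedAddCommGroup E] [NormedSpace ℝ E]
    [FiniteDimensional ℝ E] {V : E → E} {K U : Set E} (hK : IsCompact K) (hU : IsOpen U)
    (hKU : K ⊆ U) (hV : ContDiffOn ℝ 1 V U) :
    ∃ χ : E → ℝ, (∀ z ∈ K, χ z = 1) ∧ (∀ z ∉ U, χ z = 0) ∧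
      (∃ C : ℝ≥0, LipschitzWith C fun z => χ z • V z) ∧
      ∃ M : ℝ≥0, ∀ z, ‖χ z • V z‖ ≤ M := by
  -- The cutoff lives in a compact `Q` inside `U`, so the product is C¹ also where `V` is not
  -- smooth.
  obtain ⟨Q, hQ, hKQ, hQU⟩ := exists_compact_between hK hU hKU
  obtain ⟨χ, h1, h0, -⟩ := exists_contMDiffMap_one_nhds_of_subset_interior (n := 1) 𝓘(ℝ, E)
    hK.isClosed hKQ
  have hχ : ContDiff ℝ 1 χ := χ.contMDiff.contDiff
  have hsupp : ∀ z ∉ Q, χ z • V z = 0 := fun z hz => by rw [h0 z hz, zero_smul]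
  have hc : HasCompactSupport fun z => χ z • V z := HasCompactSupport.intro hQ hsupp
  have hd : ContDiff ℝ 1 fun z => χ z • V z := by
    rw [contDiff_iff_contDiffAt]
    intro z
    by_cases hz : z ∈ U
    · exact hχ.contDiffAt.smul (hV.contDiffAt (hU.mem_nhds hz))
    · have : (fun z => χ z • V z) =ᶠ[𝓝 z] fun _ => 0 := by
        filter_upwards [hQ.isClosed.isOpen_compl.mem_nhds fun h => hz (hQU h)] with w hw
          using hsupp w hw
      exact contDiffAt_const.congr_of_eventuallyEq this
  refine ⟨χ, fun z hz => h1.self_of_nhdsSet z hz, fun z hz => h0 z fun h => hz (hQU h),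
    ContDiff.lipschitzWith_of_hasCompactSupport hc hd one_ne_zero, ?_⟩
  obtain ⟨M, hM⟩ := hc.exists_bound_of_continuous hd.continuous
  exact ⟨⟨max M 0, le_max_right _ _⟩, fun z => (hM z).trans (le_max_left _ _)⟩

theorem hasDerivAt_prod_fst {E F : Type*} [NormedAddCommGroup E] [NormedSpace ℝ E]
    [NormedAddCommGroup F] [NormedSpace ℝ F] {f : ℝ → E × F} {v : E × F} {t : ℝ}
    (h : HasDerivAt f v t) : HasDerivAt (fun t => (f t).1) v.1 t := by
  simpa using h.hasFDerivAt.fst.hasDerivAt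

theorem hasDerivAt_prod_snd {E F : Type*} [NormedAddCommGroup E] [NormedSpace ℝ E]
    [NormedAddCommGroup F] [NormedSpace ℝ F] {f : ℝ → E × F} {v : E × F} {t : ℝ}
    (h : HasDerivAt f v t) : HasDerivAt (fun t => (f t).2) v.2 t := by
  simpa using h.hasFDerivAt.snd.hasDerivAt

theorem hasDerivAt_euclidean {ι : Type*} [Fintype ι] {f : ℝ → EuclideanSpace ℝ ι}
    {v : EuclideanSpace ℝ ι} {t : ℝ} :
    HasDerivAt f v t ↔ ∀ j, HasDerivAt (fun t => f t j) (v j) t := by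
  simp_rw [← hasDerivWithinAt_univ, hasDerivWithinAt_iff_hasFDerivWithinAt]
  rw [hasFDerivWithinAt_euclidean]
  refine forall_congr' fun j => iff_of_eq
    (congrArg (fun L => HasFDerivWithinAt (fun t => f t j) L Set.univ t) ?_)
  ext
  simp

/-- The multiplier `(B y, y) / (B x, B x)` of the geodesic through `x` with velocity `y`. -/
noncomputable def multiplier (a : Fin n → ℝ)
    (z : EuclideanSpace ℝ (Fin n) × EuclideanSpace ℝ (Fin n)) : ℝ :=
  (∑ j, z.2 j ^ 2 / a j) / ∑ j, (z.1 j / a j) ^ 2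

/-- The geodesic vector field on the phase space of the quadric. -/
noncomputable def geodesicField (a : Fin n → ℝ)
    (z : EuclideanSpace ℝ (Fin n) × EuclideanSpace ℝ (Fin n)) :
    EuclideanSpace ℝ (Fin n) × EuclideanSpace ℝ (Fin n) :=
  (z.2, WithLp.toLp 2 fun j => -multiplier a z * (z.1 j / a j))

/-- The unit tangent bundle of the quadric. -/
def unitTangentBundle (a : Fin n → ℝ) :
    Set (EuclideanSpace ℝ (Fin n) × EuclideanSpace ℝ (Fin n)) :=
  {z | ∑ j, z.1 j ^ 2 / a j = 1 ∧ ∑ j, z.1 j * z.2 j / a j = 0 ∧ ∑ j, z.2 j ^ 2 = 1}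

theorem sum_div_sq_pos_of_mem {a : Fin n → ℝ} {z}
    (hz : z ∈ unitTangentBundle a) : 0 < ∑ j, (z.1 j / a j) ^ 2 := by
  refine lt_of_le_of_ne (Finset.sum_nonneg fun j _ => sq_nonneg _) fun h => ?_
  have h0 := (Finset.sum_eq_zero_iff_of_nonneg fun j _ => sq_nonneg _).1 h.symm
  have : ∑ j, z.1 j ^ 2 / a j = 0 := Finset.sum_eq_zero fun j hj => by
    have := pow_eq_zero_iff two_ne_zero |>.1 (h0 j hj)
    rw [sq, mul_div_assoc, this, mul_zero]
  rw [hz.1] at this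
  exact one_ne_zero this

theorem isCompact_unitTangentBundle {a : Fin n → ℝ} (ha : ∀ j, 0 < a j) :
    IsCompact (unitTangentBundle a) := by
  rw [Metric.isCompact_iff_isClosed_bounded]
  constructor
  · have h1 : IsClosed {z : EuclideanSpace ℝ (Fin n) × EuclideanSpace ℝ (Fin n) |
        ∑ j, z.1 j ^ 2 / a j = 1} := isClosed_eq (by fun_prop) (by fun_prop)
    have h2 : IsClosed {z : EuclideanSpace ℝ (Fin n) × EuclideanSpace ℝ (Fin n) |
        ∑ j, z.1 j * z.2 j / a j = 0} := isClosed_eq (by fun_prop) (by fun_prop)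
    have h3 : IsClosed {z : EuclideanSpace ℝ (Fin n) × EuclideanSpace ℝ (Fin n) |
        ∑ j, z.2 j ^ 2 = 1} := isClosed_eq (by fun_prop) (by fun_prop)
    exact h1.inter (h2.inter h3)
  · rw [isBounded_iff_forall_norm_le]
    refine ⟨max (√(∑ j, a j)) 1, fun z hz => ?_⟩
    refine max_le_max ?_ ?_
    · rw [EuclideanSpace.norm_eq]
      refine Real.sqrt_le_sqrt (Finset.sum_le_sum fun j _ => ?_)
      have : z.1 j ^ 2 / a j ≤ 1 := by
        rw [← hz.1]
        exact Finset.single_le_sum (f := fun j => z.1 j ^ 2 / a j)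
          (fun i _ => div_nonneg (sq_nonneg _) (ha i).le) (Finset.mem_univ j)
      rw [div_le_one (ha j)] at this
      simpa using this
    · rw [EuclideanSpace.norm_eq]
      simp [hz.2.2]

theorem contDiffOn_geodesicField (a : Fin n → ℝ) :
    ContDiffOn ℝ 1 (geodesicField a) {z | ∑ j, (z.1 j / a j) ^ 2 ≠ 0} := by
  have hm : ContDiffOn ℝ 1 (multiplier a) {z | ∑ j, (z.1 j / a j) ^ 2 ≠ 0} := by
    unfold multiplier
    refine ContDiffOn.div (by fun_prop) (by fun_prop) fun z hz => hz
  refine contDiffOn_snd.prodMk ?_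
  rw [contDiffOn_euclidean]
  intro j
  exact hm.neg.mul (by fun_prop)

/-- The geodesic field is tangent to the unit tangent bundle, and so is any multiple of it. Hence
the cut-off flow preserves this compact set, where it agrees with the geodesic flow. Tangency of the
velocity comes first, since the other two conservation laws rest on it. -/
theorem exists_geodesicField_cutoff {a : Fin n → ℝ} (ha : ∀ j, 0 < a j) :
    ∃ (W : EuclideanSpace ℝ (Fin n) × EuclideanSpace ℝ (Fin n) →
        EuclideanSpace ℝ (Fin n) × EuclideanSpace ℝ (Fin n)) (C : ℝ≥0), LipschitzWith C W ∧
      (∀ z ∈ unitTangentBundle a, W z = geodesicField a z) ∧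
      ∀ z ∈ unitTangentBundle a, ∃ f : ℝ → _, f 0 = z ∧ (∀ t, HasDerivAt f (W (f t)) t) ∧
        ∀ t, f t ∈ unitTangentBundle a := by
  have hUo : IsOpen {z : EuclideanSpace ℝ (Fin n) × EuclideanSpace ℝ (Fin n) |
      ∑ j, (z.1 j / a j) ^ 2 ≠ 0} := isOpen_ne_fun (by fun_prop) (by fun_prop)
  obtain ⟨χ, h1, h0, ⟨C, hC⟩, M, hM⟩ := exists_lipschitz_cutoff (isCompact_unitTangentBundle ha)
    hUo (fun z hz => (sum_div_sq_pos_of_mem hz).ne') (contDiffOn_geodesicField a)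
  refine ⟨_, C, hC, fun z hz => by rw [h1 z hz, one_smul], fun z hz => ?_⟩
  obtain ⟨f, hf0, hf⟩ := exists_global_integralCurve hC hM z
  refine ⟨f, hf0, hf, fun t => ?_⟩
  have hX : ∀ t j, HasDerivAt (fun t => (f t).1 j) (χ (f t) * (f t).2 j) t := fun t j => by
    have := hasDerivAt_euclidean.1 (hasDerivAt_prod_fst (hf t)) j
    simpa [geodesicField] using this
  have hY : ∀ t j, HasDerivAt (fun t => (f t).2 j)
      (χ (f t) * (-multiplier a (f t) * ((f t).1 j / a j))) t := fun t j => by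
    have := hasDerivAt_euclidean.1 (hasDerivAt_prod_snd (hf t)) j
    simpa [geodesicField] using this
  have const : ∀ {g : ℝ → ℝ}, (∀ t, HasDerivAt g 0 t) → ∀ t, g t = g 0 := fun hg t =>
    is_const_of_deriv_eq_zero (fun t => (hg t).differentiableAt) (fun t => (hg t).deriv) t 0
  have c2 : ∀ t, ∑ j, (f t).1 j * (f t).2 j / a j = 0 := by
    intro t
    rw [← hz.2.1, ← hf0]
    refine const (g := fun t => ∑ j, (f t).1 j * (f t).2 j / a j) (fun t => ?_) t
    refine (HasDerivAt.fun_sum fun j _ => ((hX t j).mul (hY t j)).div_const (a j)).congr_deriv ?_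
    -- Where `B x = 0` the multiplier takes the default value of division by zero; there the cutoff
    -- vanishes.
    by_cases hq : ∑ j, ((f t).1 j / a j) ^ 2 = 0
    · have : χ (f t) = 0 := h0 _ (by simpa using hq)
      simp [this]
    · have e : multiplier a (f t) * ∑ j, ((f t).1 j / a j) ^ 2 = ∑ j, (f t).2 j ^ 2 / a j := by
        rw [multiplier, div_mul_cancel₀ _ hq]
      have : ∑ j, (χ (f t) * (f t).2 j * (f t).2 j +
          (f t).1 j * (χ (f t) * (-multiplier a (f t) * ((f t).1 j / a j)))) / a j =
          χ (f t) * (∑ j, (f t).2 j ^ 2 / a j -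
            multiplier a (f t) * ∑ j, ((f t).1 j / a j) ^ 2) := by
        rw [Finset.mul_sum, ← Finset.sum_sub_distrib, Finset.mul_sum]
        refine Finset.sum_congr rfl fun j _ => ?_
        ring
      rw [this, e, sub_self, mul_zero]
  refine ⟨?_, c2 t, ?_⟩
  · rw [← hz.1, ← hf0]
    refine const (g := fun t => ∑ j, (f t).1 j ^ 2 / a j) (fun t => ?_) t
    refine (HasDerivAt.fun_sum fun j _ => ((hX t j).pow 2).div_const (a j)).congr_deriv ?_
    have : ∀ j, ((2 : ℕ) * (f t).1 j ^ (2 - 1) * (χ (f t) * (f t).2 j)) / a j =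
      2 * χ (f t) * ((f t).1 j * (f t).2 j / a j) := fun j => by norm_num; ring
    simp_rw [this, ← Finset.mul_sum, c2, mul_zero]
  · rw [← hz.2.2, ← hf0]
    refine const (g := fun t => ∑ j, (f t).2 j ^ 2) (fun t => ?_) t
    refine (HasDerivAt.fun_sum fun j _ => ((hY t j).pow 2)).congr_deriv ?_
    have : ∀ j, ((2 : ℕ) * (f t).2 j ^ (2 - 1) *
        (χ (f t) * (-multiplier a (f t) * ((f t).1 j / a j)))) =
      -2 * χ (f t) * multiplier a (f t) * ((f t).1 j * (f t).2 j / a j) := fun j => by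
        norm_num; ring
    simp_rw [this, ← Finset.mul_sum, c2, mul_zero]

theorem isGeodesic_of_hasDerivAt {a : Fin n → ℝ}
    {f : ℝ → EuclideanSpace ℝ (Fin n) × EuclideanSpace ℝ (Fin n)}
    (hf : ∀ t, HasDerivAt f (geodesicField a (f t)) t) (hfK : ∀ t, f t ∈ unitTangentBundle a) :
    IsGeodesic a fun t => (f t).1 := by
  have h1 : deriv (fun t => (f t).1) = fun t => (f t).2 := funext fun t => (hasDerivAt_prod_fst (hf t)).deriv
  have hfc : Continuous f := continuous_iff_continuousAt.2 fun t => (hf t).continuousAt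
  have h2 : deriv (fun t => (f t).2) = fun t => (geodesicField a (f t)).2 :=
    funext fun t => (hasDerivAt_prod_snd (hf t)).deriv
  refine ⟨?_, fun s => (hfK s).1, fun s => ?_, ⟨fun t => multiplier a (f t), fun s k => ?_⟩⟩
  · rw [show (2 : WithTop ℕ∞) = 1 + 1 from rfl, contDiff_succ_iff_deriv]
    refine ⟨fun t => (hasDerivAt_prod_fst (hf t)).differentiableAt, by simp, ?_⟩
    rw [h1, contDiff_one_iff_deriv]
    refine ⟨fun t => (hasDerivAt_prod_snd (hf t)).differentiableAt, ?_⟩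
    rw [h2]
    have := (contDiffOn_geodesicField a).continuousOn.comp_continuous hfc
      fun t => (sum_div_sq_pos_of_mem (hfK t)).ne'
    exact this.snd
  · rw [h1, EuclideanSpace.norm_eq]
    simp [(hfK s).2.2]
  · rw [h1, h2]
    rfl

/-- A forward time change of a geodesic, given for all positive times, extends to a complete
geodesic. -/
theorem exists_isGeodesic_of_time_change {a : Fin n → ℝ} (ha : ∀ j, 0 < a j)
    {z : ℝ → EuclideanSpace ℝ (Fin n) × EuclideanSpace ℝ (Fin n)}
    (hz : ∀ t, z t ∈ unitTangentBundle a) {v : ℝ → ℝ} (hv : Continuous v)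
    (hzv : ∀ t, HasDerivAt z (v t • geodesicField a (z t)) t) :
    ∃ g : ℝ → EuclideanSpace ℝ (Fin n), IsGeodesic a g ∧
      ∀ s, 0 ≤ s → (z s).1 = g (∫ t in (0 : ℝ)..s, v t) := by
  obtain ⟨W, C, hW, hWK, hex⟩ := exists_geodesicField_cutoff ha
  obtain ⟨f, hf0, hf, hfK⟩ := hex (z 0) (hz 0)
  refine ⟨fun t => (f t).1, isGeodesic_of_hasDerivAt (fun t => hWK _ (hfK t) ▸ hf t) hfK, ?_⟩
  intro s hs
  obtain ⟨M, hM⟩ := isCompact_Icc.exists_bound_of_continuousOn (s := Set.Icc 0 s) hv.continuousOn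
  have hτ : ∀ t, HasDerivAt (fun s => ∫ t in (0 : ℝ)..s, v t) (v t) t := fun t =>
    intervalIntegral.integral_hasDerivAt_right (hv.intervalIntegrable _ _)
      (hv.stronglyMeasurableAtFilter _ _) hv.continuousAt
  have hfτ : ∀ t, HasDerivAt (fun s => f (∫ t in (0 : ℝ)..s, v t))
      (v t • W (f (∫ t in (0 : ℝ)..t, v t))) t := fun t =>
    (hf _).scomp t (hτ t)
  have hzW : ∀ t, HasDerivAt z (v t • W (z t)) t := fun t => by
    rw [hWK _ (hz t)]; exact hzv t
  -- Both curves solve w' = v(t) W(w) with the same initial value; the Lipschitz constant is uniform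
  -- because `v` is bounded on [0, s].
  have heq := ODE_solution_unique_of_mem_Icc_right (v := fun t w => v t • W w)
    (s := fun _ => Set.univ) (K := (M.toNNReal * C)) (f := z)
    (g := fun s => f (∫ t in (0 : ℝ)..s, v t)) (a := 0) (b := s)
    (fun t ht => LipschitzWith.lipschitzOnWith (LipschitzWith.of_dist_le_mul fun x y => by
      have h1 : |v t| ≤ M := hM t ⟨ht.1, ht.2.le⟩
      rw [dist_smul₀, NNReal.coe_mul, mul_assoc, Real.norm_eq_abs]
      have := hW.dist_le_mul x y
      have h2 : (M.toNNReal : ℝ) = M := Real.coe_toNNReal _ ((abs_nonneg _).trans h1)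
      rw [h2]
      exact mul_le_mul h1 this dist_nonneg ((abs_nonneg _).trans h1)))
    (fun t _ => (hzW t).continuousAt.continuousWithinAt) (fun t _ => (hzW t).hasDerivWithinAt)
    (fun _ _ => trivial)
    (fun t _ => (hfτ t).continuousAt.continuousWithinAt) (fun t _ => (hfτ t).hasDerivWithinAt)
    (fun _ _ => trivial) (by simp [hf0])
  exact congrArg Prod.fst (heq ⟨hs, le_rfl⟩)

/-! ### Growth estimates for functions of one variable -/

/-- If `f' ≥ c` to the right of `s₁`, then `f` grows at least linearly there. -/
theorem add_mul_le_of_le_hasDerivAt {f f' : ℝ → ℝ} {c s₁ : ℝ} (hf : ∀ s, HasDerivAt f (f' s) s)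
    (hc : ∀ s, s₁ ≤ s → c ≤ f' s) {s : ℝ} (hs : s₁ ≤ s) : f s₁ + c * (s - s₁) ≤ f s := by
  have hd : ∀ s, HasDerivAt (fun s => f s - c * s) (f' s - c) s := fun s => by
    exact ((hf s).sub ((hasDerivAt_id s).const_mul c)).congr_deriv (by simp)
  have hm : MonotoneOn (fun s => f s - c * s) (Set.Ici s₁) := by
    refine monotoneOn_of_hasDerivWithinAt_nonneg (convex_Ici _)
      (fun s _ => (hd s).continuousAt.continuousWithinAt)
      (fun s _ => (hd s).hasDerivWithinAt) fun s hs => ?_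
    rw [interior_Ici] at hs
    exact sub_nonneg.2 (hc s (le_of_lt hs))
  have := hm (Set.mem_Ici.2 le_rfl) (Set.mem_Ici.2 hs) hs
  simp only at this
  linarith

theorem tendsto_atTop_of_le_hasDerivAt {f f' : ℝ → ℝ} {c s₁ : ℝ}
    (hf : ∀ s, HasDerivAt f (f' s) s) (hc0 : 0 < c) (hc : ∀ s, s₁ ≤ s → c ≤ f' s) :
    Tendsto f atTop atTop := by
  refine tendsto_atTop_mono' atTop (f₁ := fun s => f s₁ + c * (s - s₁)) ?_ ?_
  · filter_upwards [eventually_ge_atTop s₁] with s hs using add_mul_le_of_le_hasDerivAt hf hc hs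
  · exact tendsto_atTop_add_const_left _ _
      ((tendsto_atTop_add_const_right _ (-s₁) tendsto_id).const_mul_atTop hc0)

/-- If `f' ≤ k f`, then `f` grows at most like `exp (k s)`. -/
theorem le_mul_exp_of_hasDerivAt_le {f f' : ℝ → ℝ} {k s₁ : ℝ} (hf : ∀ s, HasDerivAt f (f' s) s)
    (hk : ∀ s, s₁ ≤ s → f' s ≤ k * f s) {s : ℝ} (hs : s₁ ≤ s) :
    f s ≤ f s₁ * Real.exp (k * (s - s₁)) := by
  have hd : ∀ s, HasDerivAt (fun s => -(f s * Real.exp (-k * (s - s₁))))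
      (-(f' s * Real.exp (-k * (s - s₁)) + f s * (Real.exp (-k * (s - s₁)) * -k))) s := fun s => by
    have h1 : HasDerivAt (fun s => -k * (s - s₁)) (-k) s := by
      simpa using ((hasDerivAt_id s).sub_const s₁).const_mul (-k)
    exact ((hf s).mul h1.exp).neg
  have := add_mul_le_of_le_hasDerivAt (c := 0) (s₁ := s₁) hd (fun s hs => by
    have := mul_le_mul_of_nonneg_right (hk s hs) (Real.exp_pos (-k * (s - s₁))).le
    nlinarith) hs
  simp only [sub_self, mul_zero, Real.exp_zero, mul_one, zero_mul, add_zero, neg_le_neg_iff] at this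
  have h2 := mul_le_mul_of_nonneg_right this (Real.exp_pos (k * (s - s₁))).le
  rwa [mul_assoc, ← Real.exp_add, show -k * (s - s₁) + k * (s - s₁) = 0 by ring, Real.exp_zero,
    mul_one] at h2

/-! ### First integrals and curvature bounds in split coordinates -/

/-- A geodesic on the quadric `-x₀² / α + ∑ x_j² / a_j = 1` in coordinates: the coordinate `x₀` and
its velocity `y₀`, the remaining coordinates `X` and velocities `Y`, and the multiplier `lam`. -/
structure SplitGeodesic (α : ℝ) (a : Fin n → ℝ) (x₀ y₀ lam : ℝ → ℝ) (X Y : ℝ → Fin n → ℝ) :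
    Prop where
  hx₀ : ∀ s, HasDerivAt x₀ (y₀ s) s
  hy₀ : ∀ s, HasDerivAt y₀ (lam s * x₀ s / α) s
  hX : ∀ s j, HasDerivAt (fun t => X t j) (Y s j) s
  hY : ∀ s j, HasDerivAt (fun t => Y t j) (-lam s * (X s j / a j)) s
  quadric : ∀ s, ∑ j, X s j ^ 2 / a j = 1 + x₀ s ^ 2 / α
  speed : ∀ s, y₀ s ^ 2 + ∑ j, Y s j ^ 2 = 1

/-- The Uhlenbeck-Devaney function of the coordinate `x₀`, as a function of split coordinates. -/
noncomputable def splitIntegral (α : ℝ) (a : Fin n → ℝ) (x₀ y₀ : ℝ) (X Y : Fin n → ℝ) : ℝ :=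
  y₀ ^ 2 - ∑ j, (x₀ * Y j - X j * y₀) ^ 2 / (a j + α)

/-- The squared length of the normal `B x` in split coordinates. -/
noncomputable def splitNormalSq (α : ℝ) (a : Fin n → ℝ) (x₀ : ℝ) (X : Fin n → ℝ) : ℝ :=
  x₀ ^ 2 / α ^ 2 + ∑ j, X j ^ 2 / a j ^ 2

namespace SplitGeodesic

variable {α : ℝ} {a : Fin n → ℝ} {x₀ y₀ lam : ℝ → ℝ} {X Y : ℝ → Fin n → ℝ}

/-- Together with `reverse`, this symmetry reduces all sign patterns of (x₀, y₀) to a single one. -/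
theorem neg (h : SplitGeodesic α a x₀ y₀ lam X Y) :
    SplitGeodesic α a (fun s => -x₀ s) (fun s => -y₀ s) lam X Y where
  hx₀ s := (h.hx₀ s).neg
  hy₀ s := (h.hy₀ s).neg.congr_deriv (by ring)
  hX := h.hX
  hY := h.hY
  quadric s := by rw [h.quadric, neg_sq]
  speed s := by rw [neg_sq, h.speed]

theorem reverse (h : SplitGeodesic α a x₀ y₀ lam X Y) :
    SplitGeodesic α a (fun s => x₀ (-s)) (fun s => -y₀ (-s)) (fun s => lam (-s))
      (fun s => X (-s)) (fun s j => -Y (-s) j) where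
  hx₀ s := ((h.hx₀ (-s)).comp s (hasDerivAt_neg s)).congr_deriv (by ring)
  hy₀ s := ((h.hy₀ (-s)).comp s (hasDerivAt_neg s)).neg.congr_deriv (by ring)
  hX s j := ((h.hX (-s) j).comp s (hasDerivAt_neg s)).congr_deriv (by ring)
  hY s j := ((h.hY (-s) j).comp s (hasDerivAt_neg s)).neg.congr_deriv (by ring)
  quadric s := h.quadric (-s)
  speed s := by simp only [neg_sq]; exact h.speed (-s)

theorem splitIntegral_reverse (x₀ y₀ : ℝ) (X Y : Fin n → ℝ) :
    splitIntegral α a x₀ (-y₀) X (fun j => -Y j) = splitIntegral α a x₀ y₀ X Y := by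
  simp only [splitIntegral, neg_sq]
  congr 1
  exact Finset.sum_congr rfl fun j _ => by ring

theorem splitIntegral_neg (x₀ y₀ : ℝ) (X Y : Fin n → ℝ) :
    splitIntegral α a (-x₀) (-y₀) X Y = splitIntegral α a x₀ y₀ X Y := by
  simp only [splitIntegral, neg_sq]
  congr 1
  exact Finset.sum_congr rfl fun j _ => by ring

theorem tangent (h : SplitGeodesic α a x₀ y₀ lam X Y) (s : ℝ) :
    ∑ j, X s j * Y s j / a j = x₀ s * y₀ s / α := by
  have h1 : HasDerivAt (fun s => ∑ j, X s j ^ 2 / a j) (∑ j, 2 * X s j * Y s j / a j) s :=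
    HasDerivAt.fun_sum fun j _ => (((h.hX s j).pow 2).div_const _).congr_deriv (by norm_num)
  have h2 : HasDerivAt (fun s => 1 + x₀ s ^ 2 / α) (2 * x₀ s * y₀ s / α) s :=
    ((((h.hx₀ s).pow 2).div_const _).const_add 1).congr_deriv (by norm_num)
  have e : (fun s => ∑ j, X s j ^ 2 / a j) = fun s => 1 + x₀ s ^ 2 / α := funext h.quadric
  rw [e] at h1
  have := h1.unique h2
  have h3 : ∑ j, 2 * X s j * Y s j / a j = 2 * ∑ j, X s j * Y s j / a j := by
    rw [Finset.mul_sum]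
    exact Finset.sum_congr rfl fun j _ => by ring
  rw [h3] at this
  linear_combination this / 2

theorem curvature (h : SplitGeodesic α a x₀ y₀ lam X Y) (s : ℝ) :
    ∑ j, Y s j ^ 2 / a j - y₀ s ^ 2 / α = lam s * splitNormalSq α a (x₀ s) (X s) := by
  have h1 : HasDerivAt (fun s => ∑ j, X s j * Y s j / a j)
      (∑ j, (Y s j ^ 2 / a j - lam s * (X s j ^ 2 / a j ^ 2))) s :=
    HasDerivAt.fun_sum fun j _ => (((h.hX s j).mul (h.hY s j)).div_const _).congr_deriv (by ring)
  have h2 : HasDerivAt (fun s => x₀ s * y₀ s / α)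
      (y₀ s ^ 2 / α + lam s * (x₀ s ^ 2 / α ^ 2)) s :=
    (((h.hx₀ s).mul (h.hy₀ s)).div_const _).congr_deriv (by ring)
  have e : (fun s => ∑ j, X s j * Y s j / a j) = fun s => x₀ s * y₀ s / α := funext h.tangent
  rw [e] at h1
  have := h1.unique h2
  rw [Finset.sum_sub_distrib, ← Finset.mul_sum] at this
  rw [splitNormalSq]
  linear_combination this

/-- Since w_j' = -λx₀X_j(a_j + α)/(a_jα), the denominator a_j + α cancels. What remains are the sums
∑ X_jY_j/a_j and ∑ X_j²/a_j, known from the quadric and its derivative. -/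
theorem splitIntegral_const (h : SplitGeodesic α a x₀ y₀ lam X Y) (hα : 0 < α)
    (ha : ∀ j, 0 < a j) (s s' : ℝ) :
    splitIntegral α a (x₀ s) (y₀ s) (X s) (Y s) =
      splitIntegral α a (x₀ s') (y₀ s') (X s') (Y s') := by
  have hd : ∀ s, HasDerivAt (fun s => splitIntegral α a (x₀ s) (y₀ s) (X s) (Y s)) 0 s := by
    intro s
    have hw : ∀ j, HasDerivAt (fun s => (x₀ s * Y s j - X s j * y₀ s) ^ 2 / (a j + α))
        (-(2 * lam s * x₀ s / α) * (x₀ s * (X s j * Y s j / a j) - y₀ s * (X s j ^ 2 / a j))) s :=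
      fun j => by
        refine (((((h.hx₀ s).mul (h.hY s j)).sub ((h.hX s j).mul (h.hy₀ s))).pow 2).div_const
          _).congr_deriv ?_
        have h1 := (ha j).ne'
        have h2 := (add_pos (ha j) hα).ne'
        have h3 := hα.ne'
        simp only [Pi.sub_apply, Pi.mul_apply]
        field_simp
        push_cast
        ring
    refine (((h.hy₀ s).pow 2).sub (HasDerivAt.fun_sum fun j (_ : j ∈ Finset.univ) =>
      hw j)).congr_deriv ?_
    rw [← Finset.mul_sum, Finset.sum_sub_distrib, ← Finset.mul_sum, ← Finset.mul_sum, h.tangent,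
      h.quadric]
    push_cast
    ring
  exact is_const_of_deriv_eq_zero (fun t => (hd t).differentiableAt) (fun t => (hd t).deriv) s s'

/-- Joachimsthal's integral. -/
theorem joachimsthal (h : SplitGeodesic α a x₀ y₀ lam X Y) (s s' : ℝ) :
    lam s * splitNormalSq α a (x₀ s) (X s) ^ 2 =
      lam s' * splitNormalSq α a (x₀ s') (X s') ^ 2 := by
  have hd : ∀ s, HasDerivAt (fun s => (∑ j, Y s j ^ 2 / a j - y₀ s ^ 2 / α) *
      splitNormalSq α a (x₀ s) (X s)) 0 s := by
    intro s
    have h1 : HasDerivAt (fun s => ∑ j, Y s j ^ 2 / a j)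
        (∑ j, -(2 * lam s) * (X s j * Y s j / a j ^ 2)) s :=
      HasDerivAt.fun_sum fun j _ => (((h.hY s j).pow 2).div_const _).congr_deriv
        (by push_cast; ring)
    have h2 : HasDerivAt (fun s => ∑ j, X s j ^ 2 / a j ^ 2)
        (∑ j, 2 * (X s j * Y s j / a j ^ 2)) s :=
      HasDerivAt.fun_sum fun j _ => (((h.hX s j).pow 2).div_const _).congr_deriv
        (by push_cast; ring)
    refine ((h1.sub (((h.hy₀ s).pow 2).div_const _)).mul
      ((((h.hx₀ s).pow 2).div_const _).add h2)).congr_deriv ?_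
    -- The first factor has derivative -λN' and by `curvature` equals λN, so the two terms of the
    -- product rule cancel.
    have hc := h.curvature s
    rw [splitNormalSq] at hc
    simp only [Pi.sub_apply, Pi.add_apply, Pi.pow_apply]
    rw [← Finset.mul_sum, ← Finset.mul_sum, hc]
    push_cast
    ring
  have := is_const_of_deriv_eq_zero (fun t => (hd t).differentiableAt) (fun t => (hd t).deriv) s s'
  rw [h.curvature, h.curvature] at this
  linear_combination this

/-- With weights 1/a_j the sum expands into quantities fixed by the quadric. Comparing it with the
weights 1/(a_j + α) of the first integral bounds the curvature. -/
theorem sum_wronskian_sq (h : SplitGeodesic α a x₀ y₀ lam X Y) (s : ℝ) :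
    ∑ j, (x₀ s * Y s j - X s j * y₀ s) ^ 2 / a j =
      x₀ s ^ 2 * (lam s * splitNormalSq α a (x₀ s) (X s)) + y₀ s ^ 2 := by
  have e : ∑ j, (x₀ s * Y s j - X s j * y₀ s) ^ 2 / a j =
      x₀ s ^ 2 * ∑ j, Y s j ^ 2 / a j - 2 * x₀ s * y₀ s * ∑ j, X s j * Y s j / a j +
        y₀ s ^ 2 * ∑ j, X s j ^ 2 / a j := by
    simp only [Finset.mul_sum, ← Finset.sum_sub_distrib, ← Finset.sum_add_distrib]
    exact Finset.sum_congr rfl fun j _ => by ring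
  rw [e, h.tangent, h.quadric]
  linear_combination x₀ s ^ 2 * h.curvature s

/-- Lower bound for the normal curvature in terms of the first integral. -/
theorem le_curvature (h : SplitGeodesic α a x₀ y₀ lam X Y) (hα : 0 < α) (ha : ∀ j, 0 < a j)
    {C : ℝ} (hC : ∀ j, a j ≤ C) (s : ℝ) :
    α / C * y₀ s ^ 2 - (1 + α / C) * splitIntegral α a (x₀ s) (y₀ s) (X s) (Y s) ≤
      x₀ s ^ 2 * (lam s * splitNormalSq α a (x₀ s) (X s)) := by
  have key : (1 + α / C) * ∑ j, (x₀ s * Y s j - X s j * y₀ s) ^ 2 / (a j + α) ≤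
      ∑ j, (x₀ s * Y s j - X s j * y₀ s) ^ 2 / a j := by
    rw [Finset.mul_sum]
    refine Finset.sum_le_sum fun j _ => ?_
    have h1 : α / C ≤ α / a j := div_le_div_of_nonneg_left hα.le (ha j) (hC j)
    have h2 := add_pos (ha j) hα
    have e : (x₀ s * Y s j - X s j * y₀ s) ^ 2 / a j =
        (1 + α / a j) * ((x₀ s * Y s j - X s j * y₀ s) ^ 2 / (a j + α)) := by
      have := (ha j).ne'
      field_simp
    rw [e]
    gcongr
  rw [h.sum_wronskian_sq] at key
  rw [splitIntegral]
  linarith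

theorem splitNormalSq_pos (h : SplitGeodesic α a x₀ y₀ lam X Y) (hα : 0 < α) (s : ℝ) :
    0 < splitNormalSq α a (x₀ s) (X s) := by
  have h2 : 0 ≤ ∑ j, X s j ^ 2 / a j ^ 2 :=
    Finset.sum_nonneg fun j _ => div_nonneg (sq_nonneg _) (sq_nonneg _)
  refine add_pos_of_nonneg_of_pos (by positivity) (lt_of_le_of_ne h2 fun h3 => ?_)
  have h0 := (Finset.sum_eq_zero_iff_of_nonneg
    fun j _ => div_nonneg (sq_nonneg _) (sq_nonneg _)).1 h3.symm
  have h4 : ∑ j, X s j ^ 2 / a j = 0 := Finset.sum_eq_zero fun j hj => by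
    have := h0 j hj
    rw [← div_pow] at this
    rw [sq, mul_div_assoc, pow_eq_zero_iff two_ne_zero |>.1 this, mul_zero]
  have := h.quadric s
  have : 0 ≤ x₀ s ^ 2 / α := by positivity
  linarith

theorem splitNormalSq_le (h : SplitGeodesic α a x₀ y₀ lam X Y) (ha : ∀ j, 0 < a j)
    {c : ℝ} (hc0 : 0 < c) (hc : ∀ j, c ≤ a j) (s : ℝ) :
    splitNormalSq α a (x₀ s) (X s) ≤ x₀ s ^ 2 / α ^ 2 + (1 + x₀ s ^ 2 / α) / c := by
  rw [splitNormalSq, ← h.quadric s, Finset.sum_div]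
  refine add_le_add le_rfl (Finset.sum_le_sum fun j _ => ?_)
  rw [div_div]
  have := ha j
  refine div_le_div_of_nonneg_left (sq_nonneg _) (by positivity) ?_
  nlinarith [hc j]

theorem curvature_le (h : SplitGeodesic α a x₀ y₀ lam X Y) (hα : 0 < α)
    {c : ℝ} (hc0 : 0 < c) (hc : ∀ j, c ≤ a j) (s : ℝ) :
    lam s * splitNormalSq α a (x₀ s) (X s) ≤ 1 / c := by
  rw [← h.curvature]
  have h1 : ∑ j, Y s j ^ 2 / a j ≤ ∑ j, Y s j ^ 2 / c :=
    Finset.sum_le_sum fun j _ => div_le_div_of_nonneg_left (sq_nonneg _) hc0 (hc j)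
  rw [← Finset.sum_div] at h1
  have h2 : (∑ j, Y s j ^ 2) / c ≤ 1 / c := by
    have := h.speed s
    gcongr
    nlinarith [sq_nonneg (y₀ s)]
  have : 0 ≤ y₀ s ^ 2 / α := by positivity
  linarith

/-- Bounding by sums instead of a minimum and a maximum also covers an empty index set. -/
theorem exists_bounds (ha : ∀ j, 0 < a j) :
    ∃ c C : ℝ, 0 < c ∧ 0 < C ∧ (∀ j, c ≤ a j) ∧ ∀ j, a j ≤ C := by
  have h1 : ∀ j, 1 / a j ≤ 1 + ∑ i, 1 / a i := fun j => by
    have := Finset.single_le_sum (f := fun i => 1 / a i) (fun i _ => (one_div_pos.2 (ha i)).le)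
      (Finset.mem_univ j)
    linarith
  have h2 : ∀ j, a j ≤ 1 + ∑ i, a i := fun j => by
    have := Finset.single_le_sum (f := a) (fun i _ => (ha i).le) (Finset.mem_univ j)
    linarith
  have p1 : 0 < 1 + ∑ i, 1 / a i := by
    have := Finset.sum_nonneg fun i (_ : i ∈ Finset.univ) => (one_div_pos.2 (ha i)).le
    linarith
  have p2 : 0 < 1 + ∑ i, a i := by
    have := Finset.sum_nonneg fun i (_ : i ∈ Finset.univ) => (ha i).le
    linarith
  exact ⟨_, _, one_div_pos.2 p1, p2, fun j => one_div_le (ha j) p1 |>.1 (h1 j), h2⟩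

/-! ### Escape for negative and comparison for vanishing first integral -/

/-- A geodesic with negative first integral on the side `x₀ > 0` escapes to `x₀ = +∞`. -/
theorem tendsto_atTop_of_neg (h : SplitGeodesic α a x₀ y₀ lam X Y) (hα : 0 < α)
    (ha : ∀ j, 0 < a j) {F : ℝ}
    (hF : ∀ s, splitIntegral α a (x₀ s) (y₀ s) (X s) (Y s) = F) (hF0 : F < 0)
    (hpos : ∀ s, 0 < x₀ s) : Tendsto x₀ atTop atTop := by
  obtain ⟨c, C, hc0, hC0, hc, hC⟩ := exists_bounds ha
  have hcurv : ∀ s, -F ≤ x₀ s ^ 2 * (lam s * splitNormalSq α a (x₀ s) (X s)) := fun s => by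
    have := h.le_curvature hα ha hC s
    rw [hF] at this
    have h1 : 0 ≤ α / C * y₀ s ^ 2 := by positivity
    have h2 : 0 ≤ α / C * -F := mul_nonneg (by positivity) (by linarith)
    nlinarith
  have hacc : ∀ s, lam s * x₀ s / α = x₀ s ^ 2 * (lam s * splitNormalSq α a (x₀ s) (X s)) /
      (x₀ s * splitNormalSq α a (x₀ s) (X s) * α) := fun s => by
    have h1 := (h.splitNormalSq_pos hα s).ne'
    have h2 := (hpos s).ne'
    field_simp
  have hacc0 : ∀ s, 0 ≤ lam s * x₀ s / α := fun s => by
    rw [hacc]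
    have h1 := h.splitNormalSq_pos hα s
    have h2 := hpos s
    exact div_nonneg (by linarith [hcurv s]) (by positivity)
  have hmono : ∀ {s s'}, s ≤ s' → y₀ s ≤ y₀ s' := fun {s s'} hs => by
    have := add_mul_le_of_le_hasDerivAt (c := 0) h.hy₀ (fun s _ => hacc0 s) hs
    linarith
  by_cases hy : ∃ s₁, 0 < y₀ s₁
  · obtain ⟨s₁, h1⟩ := hy
    exact tendsto_atTop_of_le_hasDerivAt h.hx₀ h1 fun s hs => hmono hs
  · push Not at hy
    exfalso
    -- If y₀ never became positive, x₀ would stay bounded for s ≥ 0, hence so would the normal. The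
    -- acceleration would then have a positive lower bound and push y₀ above zero.
    have hle : ∀ s, 0 ≤ s → x₀ s ≤ x₀ 0 := fun s hs => by
      have := add_mul_le_of_le_hasDerivAt (c := 0) (fun s => (h.hx₀ s).neg)
        (fun s _ => neg_nonneg.2 (hy s)) hs
      simp only [Pi.neg_apply] at this
      linarith
    set Q := x₀ 0 ^ 2 / α ^ 2 + (1 + x₀ 0 ^ 2 / α) / c with hQ
    have hQ0 : 0 < Q := by positivity
    have hq : ∀ s, 0 ≤ s → splitNormalSq α a (x₀ s) (X s) ≤ Q := fun s hs => by
      refine (h.splitNormalSq_le ha hc0 hc s).trans ?_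
      have := hle s hs
      have := (hpos s).le
      rw [hQ]
      gcongr
    have h0 := hpos 0
    have hlow : ∀ s, 0 ≤ s → -F / (x₀ 0 * Q * α) ≤ lam s * x₀ s / α := fun s hs => by
      rw [hacc]
      have h1 := h.splitNormalSq_pos hα s
      have h2 := hpos s
      have h3 := hle s hs
      have h4 := hq s hs
      have h5 := hcurv s
      have h6 : 0 ≤ x₀ s ^ 2 * (lam s * splitNormalSq α a (x₀ s) (X s)) := by linarith
      gcongr
    have hT := tendsto_atTop_of_le_hasDerivAt h.hy₀
      (div_pos (neg_pos.2 hF0) (by positivity)) hlow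
    obtain ⟨s, hs⟩ := (hT.eventually_gt_atTop 0).exists
    exact absurd hs (not_lt.2 (hy s))

/-- With vanishing first integral the velocity `y₀` is controlled by `x₀`. -/
theorem exists_sq_le_of_zero (h : SplitGeodesic α a x₀ y₀ lam X Y) (hα : 0 < α)
    (ha : ∀ j, 0 < a j)
    (hF : ∀ s, splitIntegral α a (x₀ s) (y₀ s) (X s) (Y s) = 0) :
    ∃ K : ℝ, 0 < K ∧ ∀ s, y₀ s ^ 2 ≤ K ^ 2 * x₀ s ^ 2 := by
  obtain ⟨c, C, hc0, hC0, hc, hC⟩ := exists_bounds ha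
  refine ⟨√(C / (α * c)), by positivity, fun s => ?_⟩
  rw [Real.sq_sqrt (by positivity)]
  have h1 := h.le_curvature hα ha hC s
  rw [hF, mul_zero, sub_zero] at h1
  have h2 := mul_le_mul_of_nonneg_left (h.curvature_le hα hc0 hc s) (sq_nonneg (x₀ s))
  have h3 : α / C * y₀ s ^ 2 ≤ x₀ s ^ 2 * (1 / c) := h1.trans h2
  calc y₀ s ^ 2 = C / α * (α / C * y₀ s ^ 2) := by field_simp
    _ ≤ C / α * (x₀ s ^ 2 * (1 / c)) := by gcongr
    _ = C / (α * c) * x₀ s ^ 2 := by field_simp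

/-- From |y₀| ≤ K|x₀| follows (x₀²)' ≤ 2Kx₀², so Grönwall's inequality propagates a zero forwards,
and time reversal propagates it backwards. -/
theorem eq_zero_of_zero (h : SplitGeodesic α a x₀ y₀ lam X Y) (hα : 0 < α)
    (ha : ∀ j, 0 < a j)
    (hF : ∀ s, splitIntegral α a (x₀ s) (y₀ s) (X s) (Y s) = 0) {s₀ : ℝ} (hs₀ : x₀ s₀ = 0)
    (s : ℝ) : x₀ s = 0 := by
  have right : ∀ {x₀ y₀ lam X Y} (_ : SplitGeodesic α a x₀ y₀ lam X Y)
      (_ : ∀ s, splitIntegral α a (x₀ s) (y₀ s) (X s) (Y s) = 0) {s₀ : ℝ} (_ : x₀ s₀ = 0)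
      (s : ℝ) (_ : s₀ ≤ s), x₀ s = 0 := by
    intro x₀ y₀ lam X Y h hF s₀ hs₀ s hs
    obtain ⟨K, hK, hle⟩ := h.exists_sq_le_of_zero hα ha hF
    have := le_mul_exp_of_hasDerivAt_le (f := fun s => x₀ s ^ 2) (f' := fun s => 2 * x₀ s * y₀ s)
      (k := 2 * K) (s₁ := s₀)
      (fun s => ((h.hx₀ s).pow 2).congr_deriv (by norm_num)) (fun s _ => by
        have h1 : |y₀ s| ≤ K * |x₀ s| := by
          refine abs_le.2 (abs_le_of_sq_le_sq' ?_ (by positivity))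
          rw [mul_pow, sq_abs]
          exact hle s
        have h2 : x₀ s * y₀ s ≤ |x₀ s| * |y₀ s| := by
          rw [← abs_mul]; exact le_abs_self _
        have h3 := mul_le_mul_of_nonneg_left h1 (abs_nonneg (x₀ s))
        nlinarith [sq_abs (x₀ s)]) hs
    simp only [hs₀, ne_eq, OfNat.ofNat_ne_zero, not_false_eq_true, zero_pow, zero_mul] at this
    exact pow_eq_zero_iff two_ne_zero |>.1 (le_antisymm this (sq_nonneg _))
  rcases le_total s₀ s with hs | hs
  · exact right h hF hs₀ s hs
  · have := right h.reverse (fun s => by rw [splitIntegral_reverse]; exact hF (-s))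
      (s₀ := -s₀) (by simpa using hs₀) (-s) (neg_le_neg hs)
    simpa using this

end SplitGeodesic

/-! ### Focal ellipsoid and contact points -/

/-- The positive root of `T β² + 2 R β = k`. -/
noncomputable def positiveRoot (k R T : ℝ) : ℝ := (√(R ^ 2 + k * T) - R) / T

/-- The last claim says that the quadratic has nonzero slope at its positive root; this later forces
the transverse part of the motion of the contact point to vanish. -/
theorem positiveRoot_spec {k R T : ℝ} (hk : 0 < k) (hT : 0 < T) :
    0 < positiveRoot k R T ∧ T * positiveRoot k R T ^ 2 + 2 * R * positiveRoot k R T = k ∧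
      0 < R + T * positiveRoot k R T := by
  have hD : 0 < R ^ 2 + k * T := by positivity
  have hsq := Real.sq_sqrt hD.le
  have e : T * positiveRoot k R T = √(R ^ 2 + k * T) - R := by
    rw [positiveRoot]; field_simp
  refine ⟨?_, ?_, ?_⟩
  · refine div_pos (sub_pos.2 ?_) hT
    refine lt_of_le_of_lt (le_abs_self R) (Real.lt_sqrt_of_sq_lt ?_)
    rw [sq_abs]
    have := mul_pos hk hT
    linarith
  · have h1 : T * (T * positiveRoot k R T ^ 2 + 2 * R * positiveRoot k R T) = T * k := by
      linear_combination (T * positiveRoot k R T + (√(R ^ 2 + k * T) - R) + 2 * R) * e + hsq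
    exact mul_left_cancel₀ hT.ne' h1
  · rw [e]
    have := Real.sqrt_pos.2 hD
    linarith

theorem differentiableAt_positiveRoot {k R T : ℝ → ℝ} {s : ℝ} (hk : DifferentiableAt ℝ k s)
    (hR : DifferentiableAt ℝ R s) (hT : DifferentiableAt ℝ T s) (hk0 : 0 < k s) (hT0 : 0 < T s) :
    DifferentiableAt ℝ (fun s => positiveRoot (k s) (R s) (T s)) s := by
  unfold positiveRoot
  have hD : R s ^ 2 + k s * T s ≠ 0 := by positivity
  exact ((((hR.pow 2).add (hk.mul hT)).sqrt hD).sub hR).div hT hT0.ne'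

/-- A point `p` moving on the focal ellipsoid `∑ p_j² / (a_j + α) = 1` with velocity `σ u`, where `u`
propagates like a tangent vector of a geodesic line congruence. -/
structure FocalMotion (α : ℝ) (a : Fin n → ℝ) (m σ : ℝ → ℝ) (p u : ℝ → Fin n → ℝ) : Prop where
  hp : ∀ s j, HasDerivAt (fun t => p t j) (σ s * u s j) s
  hu : ∀ s j, HasDerivAt (fun t => u t j) ((1 / m s - σ s) * u s j - α / a j * p s j / m s) s
  focal : ∀ s, ∑ j, p s j ^ 2 / (a j + α) = 1
  tangent : ∀ s, ∑ j, p s j * u s j / (a j + α) = 0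
  u_ne : ∀ s, ∃ j, u s j ≠ 0
  m_neg : ∀ s, m s < 0
  m_cont : Continuous m

/-- The coefficient `β` for which `γ_j = a_j / (a_j + α) (p_j + β u_j)` lies on the neck
ellipsoid. -/
noncomputable def focalCoeff (α : ℝ) (a p u : Fin n → ℝ) : ℝ :=
  positiveRoot (α * ∑ j, p j ^ 2 / (a j + α) ^ 2) (∑ j, a j * (p j * u j) / (a j + α) ^ 2)
    (∑ j, a j * u j ^ 2 / (a j + α) ^ 2)

/-- The contact point of the tangent line from `p` to the neck ellipsoid. -/
noncomputable def contactPoint (α : ℝ) (a p u : Fin n → ℝ) (j : Fin n) : ℝ :=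
  a j / (a j + α) * (p j + focalCoeff α a p u * u j)

namespace FocalMotion

variable {α : ℝ} {a : Fin n → ℝ} {m σ : ℝ → ℝ} {p u : ℝ → Fin n → ℝ}

theorem sum_p_sq_pos (h : FocalMotion α a m σ p u) (hα : 0 < α) (ha : ∀ j, 0 < a j) (s : ℝ) :
    0 < ∑ j, p s j ^ 2 / (a j + α) ^ 2 := by
  have hne : ∃ j, p s j ≠ 0 := by
    by_contra! h0
    have := h.focal s
    simp [h0] at this
  obtain ⟨j, hj⟩ := hne
  refine Finset.sum_pos' (fun i _ => by positivity) ⟨j, Finset.mem_univ j, ?_⟩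
  have := add_pos (ha j) hα
  positivity

theorem sum_u_sq_pos (h : FocalMotion α a m σ p u) (hα : 0 < α) (ha : ∀ j, 0 < a j) (s : ℝ) :
    0 < ∑ j, a j * u s j ^ 2 / (a j + α) ^ 2 := by
  obtain ⟨j, hj⟩ := h.u_ne s
  refine Finset.sum_pos' (fun i _ => ?_) ⟨j, Finset.mem_univ j, ?_⟩
  · have := (ha i).le
    positivity
  · have := add_pos (ha j) hα
    have := ha j
    positivity

theorem focalCoeff_spec (h : FocalMotion α a m σ p u) (hα : 0 < α) (ha : ∀ j, 0 < a j) (s : ℝ) :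
    0 < focalCoeff α a (p s) (u s) ∧
    (∑ j, a j * u s j ^ 2 / (a j + α) ^ 2) * focalCoeff α a (p s) (u s) ^ 2 +
      2 * (∑ j, a j * (p s j * u s j) / (a j + α) ^ 2) * focalCoeff α a (p s) (u s) =
        α * ∑ j, p s j ^ 2 / (a j + α) ^ 2 ∧
    0 < ∑ j, a j * (p s j * u s j) / (a j + α) ^ 2 +
      (∑ j, a j * u s j ^ 2 / (a j + α) ^ 2) * focalCoeff α a (p s) (u s) :=
  positiveRoot_spec (mul_pos hα (h.sum_p_sq_pos hα ha s)) (h.sum_u_sq_pos hα ha s)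

theorem differentiableAt_focalCoeff (h : FocalMotion α a m σ p u) (hα : 0 < α)
    (ha : ∀ j, 0 < a j) (s : ℝ) :
    DifferentiableAt ℝ (fun s => focalCoeff α a (p s) (u s)) s := by
  have hp : ∀ j, DifferentiableAt ℝ (fun t => p t j) s := fun j => (h.hp s j).differentiableAt
  have hu : ∀ j, DifferentiableAt ℝ (fun t => u t j) s := fun j => (h.hu s j).differentiableAt
  refine differentiableAt_positiveRoot ?_ ?_ ?_ (mul_pos hα (h.sum_p_sq_pos hα ha s))
    (h.sum_u_sq_pos hα ha s)
  · exact (DifferentiableAt.fun_sum fun j _ => ((hp j).pow 2).div_const _).const_mul _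
  · exact DifferentiableAt.fun_sum fun j _ => (((hp j).mul (hu j)).const_mul _).div_const _
  · exact DifferentiableAt.fun_sum fun j _ => (((hu j).pow 2).const_mul _).div_const _

/-- Because γ_j/a_j = (p_j + βu_j)/(a_j + α), this holds whatever β is: γ lies on the polar
hyperplane of p. -/
theorem sum_contactPoint_mul (h : FocalMotion α a m σ p u) (ha : ∀ j, 0 < a j) (s : ℝ) :
    ∑ j, contactPoint α a (p s) (u s) j * p s j / a j = 1 := by
  calc ∑ j, contactPoint α a (p s) (u s) j * p s j / a j
      = ∑ j, p s j ^ 2 / (a j + α) +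
        focalCoeff α a (p s) (u s) * ∑ j, p s j * u s j / (a j + α) := by
        rw [Finset.mul_sum, ← Finset.sum_add_distrib]
        refine Finset.sum_congr rfl fun j _ => ?_
        have := (ha j).ne'
        rw [contactPoint]
        field_simp
    _ = 1 := by rw [h.focal, h.tangent]; ring

/-- By a_j/(a_j + α)² = 1/(a_j + α) - α/(a_j + α)², membership is exactly the quadratic equation
defining β. -/
theorem contactPoint_mem (h : FocalMotion α a m σ p u) (hα : 0 < α) (ha : ∀ j, 0 < a j) (s : ℝ) :
    ∑ j, contactPoint α a (p s) (u s) j ^ 2 / a j = 1 := by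
  have e : ∑ j, contactPoint α a (p s) (u s) j ^ 2 / a j = ∑ j, p s j ^ 2 / (a j + α) -
      α * ∑ j, p s j ^ 2 / (a j + α) ^ 2 +
      ((∑ j, a j * u s j ^ 2 / (a j + α) ^ 2) * focalCoeff α a (p s) (u s) ^ 2 +
      2 * (∑ j, a j * (p s j * u s j) / (a j + α) ^ 2) * focalCoeff α a (p s) (u s)) := by
    simp only [Finset.mul_sum, Finset.sum_mul, ← Finset.sum_add_distrib, ← Finset.sum_sub_distrib]
    refine Finset.sum_congr rfl fun j _ => ?_
    have := (ha j).ne'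
    have := (add_pos (ha j) hα).ne'
    rw [contactPoint]
    field_simp
    ring
  rw [e, (h.focalCoeff_spec hα ha s).2.1, h.focal]
  ring

theorem sum_contactPoint_mul_sub (h : FocalMotion α a m σ p u) (hα : 0 < α) (ha : ∀ j, 0 < a j)
    (s : ℝ) :
    ∑ j, contactPoint α a (p s) (u s) j * (p s j - contactPoint α a (p s) (u s) j) / a j = 0 := by
  rw [← sub_self (1 : ℝ)]
  nth_rw 1 [← h.sum_contactPoint_mul ha s]
  rw [← h.contactPoint_mem hα ha s, ← Finset.sum_sub_distrib]
  exact Finset.sum_congr rfl fun j _ => by ring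

/-- Without knowing β', the derivative is a multiple of p - γ plus c times the vector with entries
a_ju_j/(a_j + α). The first part is tangent to the neck ellipsoid, the second is not, by the slope
condition on β; as γ stays on the ellipsoid, c = 0. -/
theorem hasDerivAt_contactPoint (h : FocalMotion α a m σ p u) (hα : 0 < α) (ha : ∀ j, 0 < a j)
    (s : ℝ) (j : Fin n) :
    HasDerivAt (fun s => contactPoint α a (p s) (u s) j)
      (-(focalCoeff α a (p s) (u s) / m s) * (p s j - contactPoint α a (p s) (u s) j)) s := by
  have hβ := (h.differentiableAt_focalCoeff hα ha s).hasDerivAt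
  set β := focalCoeff α a (p s) (u s) with hβdef
  set β' := deriv (fun s => focalCoeff α a (p s) (u s)) s
  have hm := (h.m_neg s).ne
  set c := σ s + β' + β / m s - β * σ s - β ^ 2 / m s with hc
  have hd : ∀ j, HasDerivAt (fun s => contactPoint α a (p s) (u s) j)
      (-(β / m s) * (p s j - contactPoint α a (p s) (u s) j) +
        c * (a j / (a j + α) * u s j)) s := fun j => by
    refine (((h.hp s j).add (hβ.mul (h.hu s j))).const_mul (a j / (a j + α))).congr_deriv ?_
    have h1 := (ha j).ne'
    have h2 := (add_pos (ha j) hα).ne'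
    rw [contactPoint, ← hβdef, hc]
    field_simp
    ring
  have hsum := HasDerivAt.fun_sum fun j (_ : j ∈ Finset.univ) => ((hd j).pow 2).div_const (a j)
  have econst : (fun s => ∑ j, contactPoint α a (p s) (u s) j ^ 2 / a j) = fun _ => 1 :=
    funext (h.contactPoint_mem hα ha)
  have h0 := hsum.unique (econst ▸ hasDerivAt_const s (1 : ℝ))
  have e : ∑ j, (((2 : ℕ) : ℝ) * contactPoint α a (p s) (u s) j ^ (2 - 1) *
      (-(β / m s) * (p s j - contactPoint α a (p s) (u s) j) + c * (a j / (a j + α) * u s j))) /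
        a j = -(2 * (β / m s)) *
        (∑ j, contactPoint α a (p s) (u s) j * (p s j - contactPoint α a (p s) (u s) j) / a j) +
      2 * c * (∑ j, a j * (p s j * u s j) / (a j + α) ^ 2 +
        (∑ j, a j * u s j ^ 2 / (a j + α) ^ 2) * β) := by
    have e1 : ∑ j, a j * (p s j * u s j) / (a j + α) ^ 2 +
        (∑ j, a j * u s j ^ 2 / (a j + α) ^ 2) * β =
        ∑ j, contactPoint α a (p s) (u s) j * (u s j / (a j + α)) := by
      simp only [Finset.sum_mul, ← Finset.sum_add_distrib]
      refine Finset.sum_congr rfl fun j _ => ?_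
      have h2 := (add_pos (ha j) hα).ne'
      rw [contactPoint, ← hβdef]
      field_simp
    rw [e1]
    simp only [Finset.mul_sum, ← Finset.sum_add_distrib]
    refine Finset.sum_congr rfl fun j _ => ?_
    have h1 := (ha j).ne'
    have h2 := (add_pos (ha j) hα).ne'
    field_simp
    push_cast
    ring
  rw [e, h.sum_contactPoint_mul_sub hα ha, mul_zero, zero_add] at h0
  have hc0 : c = 0 := by
    rcases mul_eq_zero.1 h0 with h1 | h1
    · linarith
    · exact absurd h1 (h.focalCoeff_spec hα ha s).2.2.ne'
  have := hd j
  rwa [hc0, zero_mul, add_zero] at this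

/-- If p = γ, then p would lie on both the neck and the focal ellipsoid, which are disjoint since α
> 0. -/
theorem sum_sub_sq_pos (h : FocalMotion α a m σ p u) (hα : 0 < α) (ha : ∀ j, 0 < a j) (s : ℝ) :
    0 < ∑ j, (p s j - contactPoint α a (p s) (u s) j) ^ 2 := by
  refine lt_of_le_of_ne (Finset.sum_nonneg fun j _ => sq_nonneg _) fun h0 => ?_
  have h1 : ∀ j, contactPoint α a (p s) (u s) j = p s j := fun j => by
    have := (Finset.sum_eq_zero_iff_of_nonneg fun j _ => sq_nonneg _).1 h0.symm j
      (Finset.mem_univ j)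
    exact (sub_eq_zero.1 (pow_eq_zero_iff two_ne_zero |>.1 this)).symm
  have h2 := h.contactPoint_mem hα ha s
  simp only [h1] at h2
  have h3 : ∑ j, p s j ^ 2 / (a j * (a j + α)) = 0 := by
    have : α * ∑ j, p s j ^ 2 / (a j * (a j + α)) = 0 := by
      rw [← sub_self (1 : ℝ)]
      nth_rw 1 [← h2]
      rw [← h.focal s, ← Finset.sum_sub_distrib, Finset.mul_sum]
      refine Finset.sum_congr rfl fun j _ => ?_
      have h1 := (ha j).ne'
      have h2 := (add_pos (ha j) hα).ne'
      field_simp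
      ring
    exact (mul_eq_zero.1 this).resolve_left hα.ne'
  have hpos : ∀ j, 0 < a j * (a j + α) := fun j => mul_pos (ha j) (add_pos (ha j) hα)
  have h4 := (Finset.sum_eq_zero_iff_of_nonneg
    fun j _ => div_nonneg (sq_nonneg _) (hpos j).le).1 h3
  have h5 : ∑ j, p s j ^ 2 / (a j + α) = 0 := Finset.sum_eq_zero fun j hj => by
    rw [(div_eq_zero_iff.1 (h4 j hj)).resolve_right (hpos j).ne', zero_div]
  rw [h.focal s] at h5
  exact one_ne_zero h5

/-- The definition of γ reads βu = -(p - γ) + αBγ, so the velocity σu of p splits into a part along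
p - γ and a normal part. -/
theorem hasDerivAt_sub_contactPoint (h : FocalMotion α a m σ p u) (hα : 0 < α)
    (ha : ∀ j, 0 < a j) (s : ℝ) (j : Fin n) :
    HasDerivAt (fun s => p s j - contactPoint α a (p s) (u s) j)
      ((focalCoeff α a (p s) (u s) / m s - σ s / focalCoeff α a (p s) (u s)) *
        (p s j - contactPoint α a (p s) (u s) j) +
        σ s * α / focalCoeff α a (p s) (u s) * (contactPoint α a (p s) (u s) j / a j)) s := by
  refine ((h.hp s j).sub (h.hasDerivAt_contactPoint hα ha s j)).congr_deriv ?_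
  have h1 := (ha j).ne'
  have h2 := (add_pos (ha j) hα).ne'
  have h3 := (h.focalCoeff_spec hα ha s).1.ne'
  have h4 := (h.m_neg s).ne
  rw [contactPoint]
  field_simp
  ring

/-- The distance from the focal point to the contact point. -/
noncomputable def contactDist (α : ℝ) (a p u : Fin n → ℝ) : ℝ :=
  √(∑ j, (p j - contactPoint α a p u j) ^ 2)

/-- The speed of the contact point. -/
noncomputable def contactSpeed (α : ℝ) (a : Fin n → ℝ) (m : ℝ) (p u : Fin n → ℝ) : ℝ :=
  -(focalCoeff α a p u / m) * contactDist α a p u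

/-- The contact point with its unit tangent vector. -/
noncomputable def contactElement (α : ℝ) (a p u : Fin n → ℝ) :
    EuclideanSpace ℝ (Fin n) × EuclideanSpace ℝ (Fin n) :=
  (WithLp.toLp 2 (contactPoint α a p u),
    WithLp.toLp 2 fun j => (p j - contactPoint α a p u j) / contactDist α a p u)

/-- The normal part of (p - γ)' is orthogonal to p - γ and does not change its length. -/
theorem hasDerivAt_contactDist (h : FocalMotion α a m σ p u) (hα : 0 < α)
    (ha : ∀ j, 0 < a j) (s : ℝ) :
    HasDerivAt (fun s => contactDist α a (p s) (u s))
      ((focalCoeff α a (p s) (u s) / m s - σ s / focalCoeff α a (p s) (u s)) *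
        contactDist α a (p s) (u s)) s := by
  have hpos := h.sum_sub_sq_pos hα ha s
  have hsum := HasDerivAt.fun_sum fun j (_ : j ∈ Finset.univ) =>
    (h.hasDerivAt_sub_contactPoint hα ha s j).pow 2
  refine (hsum.sqrt hpos.ne').congr_deriv ?_
  set β := focalCoeff α a (p s) (u s)
  set k := β / m s - σ s / β
  have e : ∑ j, ((2 : ℕ) : ℝ) * (p s j - contactPoint α a (p s) (u s) j) ^ (2 - 1) *
      (k * (p s j - contactPoint α a (p s) (u s) j) +
        σ s * α / β * (contactPoint α a (p s) (u s) j / a j)) =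
      2 * k * ∑ j, (p s j - contactPoint α a (p s) (u s) j) ^ 2 + 2 * (σ s * α / β) *
        ∑ j, contactPoint α a (p s) (u s) j * (p s j - contactPoint α a (p s) (u s) j) / a j := by
    simp only [Finset.mul_sum, ← Finset.sum_add_distrib]
    refine Finset.sum_congr rfl fun j _ => ?_
    push_cast
    ring
  rw [e, h.sum_contactPoint_mul_sub hα ha, contactDist]
  have hr := Real.sqrt_pos.2 hpos
  simp only [Pi.pow_apply]
  rw [mul_zero, add_zero, div_eq_iff (by positivity)]
  nth_rw 1 [← Real.mul_self_sqrt hpos.le]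
  ring

theorem contactDist_pos (h : FocalMotion α a m σ p u) (hα : 0 < α) (ha : ∀ j, 0 < a j) (s : ℝ) :
    0 < contactDist α a (p s) (u s) := Real.sqrt_pos.2 (h.sum_sub_sq_pos hα ha s)

theorem continuous_contactSpeed (h : FocalMotion α a m σ p u) (hα : 0 < α) (ha : ∀ j, 0 < a j) :
    Continuous fun s => contactSpeed α a (m s) (p s) (u s) := by
  have h1 : Continuous fun s => focalCoeff α a (p s) (u s) :=
    continuous_iff_continuousAt.2 fun s => (h.differentiableAt_focalCoeff hα ha s).continuousAt
  have h2 : Continuous fun s => contactDist α a (p s) (u s) :=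
    continuous_iff_continuousAt.2 fun s => (h.hasDerivAt_contactDist hα ha s).continuousAt
  exact (h1.div h.m_cont fun s => (h.m_neg s).ne).neg.mul h2

theorem contactElement_mem (h : FocalMotion α a m σ p u) (hα : 0 < α) (ha : ∀ j, 0 < a j)
    (s : ℝ) : contactElement α a (p s) (u s) ∈ unitTangentBundle a := by
  have hN := h.contactDist_pos hα ha s
  refine ⟨h.contactPoint_mem hα ha s, ?_, ?_⟩
  · have e : ∀ j, contactPoint α a (p s) (u s) j *
        ((p s j - contactPoint α a (p s) (u s) j) / contactDist α a (p s) (u s)) / a j =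
        contactPoint α a (p s) (u s) j * (p s j - contactPoint α a (p s) (u s) j) / a j /
          contactDist α a (p s) (u s) := fun j => by ring
    simp only [contactElement, e]
    rw [← Finset.sum_div, h.sum_contactPoint_mul_sub hα ha, zero_div]
  · simp only [contactElement, div_pow]
    rw [← Finset.sum_div, contactDist, Real.sq_sqrt (h.sum_sub_sq_pos hα ha s).le,
      div_self (h.sum_sub_sq_pos hα ha s).ne']

/-- The contact point runs along a geodesic of the neck ellipsoid. -/
theorem hasDerivAt_contactElement (h : FocalMotion α a m σ p u) (hα : 0 < α)
    (ha : ∀ j, 0 < a j) (s : ℝ) :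
    HasDerivAt (fun s => contactElement α a (p s) (u s))
      (contactSpeed α a (m s) (p s) (u s) • geodesicField a (contactElement α a (p s) (u s))) s := by
  have hN := (h.contactDist_pos hα ha s).ne'
  set v := contactSpeed α a (m s) (p s) (u s) with hv
  -- On normalising p - γ its tangential rate cancels against that of the length, leaving only this
  -- normal coefficient. It is identified with the geodesic multiplier below by differentiating the
  -- tangency condition.
  set l := σ s * α / focalCoeff α a (p s) (u s) / contactDist α a (p s) (u s) with hl
  have hγ : ∀ j, HasDerivAt (fun s => (contactElement α a (p s) (u s)).1 j)
      (v * (contactElement α a (p s) (u s)).2 j) s := fun j => by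
    refine (h.hasDerivAt_contactPoint hα ha s j).congr_deriv ?_
    simp only [hv, contactSpeed, contactElement]
    field_simp
  have hη : ∀ j, HasDerivAt (fun s => (contactElement α a (p s) (u s)).2 j)
      (l * ((contactElement α a (p s) (u s)).1 j / a j)) s := fun j => by
    refine ((h.hasDerivAt_sub_contactPoint hα ha s j).div
      (h.hasDerivAt_contactDist hα ha s) hN).congr_deriv ?_
    simp only [hl, contactElement]
    field_simp
    ring
  have hmem := h.contactElement_mem hα ha
  have hq := sum_div_sq_pos_of_mem (hmem s)
  have hl' : l = -(v * multiplier a (contactElement α a (p s) (u s))) := by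
    have hsum := HasDerivAt.fun_sum fun j (_ : j ∈ Finset.univ) =>
      ((hγ j).mul (hη j)).div_const (a j)
    have econst : (fun s => ∑ j, (contactElement α a (p s) (u s)).1 j *
        (contactElement α a (p s) (u s)).2 j / a j) = fun _ => 0 := funext fun s => (hmem s).2.1
    have h0 := hsum.unique (econst ▸ hasDerivAt_const s (0 : ℝ))
    have e : v * (∑ j, (contactElement α a (p s) (u s)).2 j ^ 2 / a j) +
        l * ∑ j, ((contactElement α a (p s) (u s)).1 j / a j) ^ 2 = 0 := by
      rw [← h0]
      simp only [Finset.mul_sum, ← Finset.sum_add_distrib]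
      exact Finset.sum_congr rfl fun j _ => by ring
    rw [multiplier, ← mul_div_assoc, ← neg_div, eq_div_iff hq.ne']
    linear_combination e
  have hfst : HasDerivAt (fun s => (contactElement α a (p s) (u s)).1)
      (v • (geodesicField a (contactElement α a (p s) (u s))).1) s :=
    hasDerivAt_euclidean.2 fun j => by simpa [geodesicField] using hγ j
  have hsnd : HasDerivAt (fun s => (contactElement α a (p s) (u s)).2)
      (v • (geodesicField a (contactElement α a (p s) (u s))).2) s :=
    hasDerivAt_euclidean.2 fun j => (hη j).congr_deriv (by
      simp only [geodesicField, PiLp.smul_apply, smul_eq_mul, hl']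
      ring)
  exact hfst.prodMk hsnd

end FocalMotion

/-! ### Asymptotics for vanishing first integral -/

/-- A function whose derivative is exponentially small converges exponentially fast. -/
theorem exists_limit_of_abs_deriv_le_exp {f f' : ℝ → ℝ} {A k : ℝ} (hk : 0 < k)
    (hf : ∀ s, HasDerivAt f (f' s) s) (hA : ∀ s, 0 ≤ s → |f' s| ≤ A * Real.exp (-k * s)) :
    ∃ L, ∀ s, 0 ≤ s → |f s - L| ≤ A / k * Real.exp (-k * s) := by
  have hA0 : 0 ≤ A := by simpa using (abs_nonneg _).trans (hA 0 le_rfl)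
  have he : ∀ s, HasDerivAt (fun s => A / k * Real.exp (-k * s)) (-(A * Real.exp (-k * s))) s :=
    fun s => by
      have h1 : HasDerivAt (fun s => -k * s) (-k) s := by
        simpa using (hasDerivAt_id s).const_mul (-k)
      refine (h1.exp.const_mul (A / k)).congr_deriv ?_
      field_simp
  -- Subtracting the error term makes `f` increasing, adding it makes `f` decreasing. The limit is
  -- the supremum of the lower envelope.
  have hlow : ∀ {s t}, 0 ≤ s → s ≤ t →
      f s - A / k * Real.exp (-k * s) ≤ f t - A / k * Real.exp (-k * t) := fun {s t} hs hst => by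
    have := add_mul_le_of_le_hasDerivAt (c := 0) (s₁ := s) (fun s => (hf s).sub (he s))
      (fun t ht => by linarith [(abs_le.1 (hA t (hs.trans ht))).1]) hst
    simp only [Pi.sub_apply] at this
    linarith
  have hupp : ∀ {s t}, 0 ≤ s → s ≤ t →
      f t + A / k * Real.exp (-k * t) ≤ f s + A / k * Real.exp (-k * s) := fun {s t} hs hst => by
    have := add_mul_le_of_le_hasDerivAt (c := 0) (s₁ := s) (fun s => ((hf s).add (he s)).neg)
      (fun t ht => by linarith [(abs_le.1 (hA t (hs.trans ht))).2]) hst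
    simp only [Pi.neg_apply, Pi.add_apply] at this
    linarith
  have hpos : ∀ s, 0 ≤ A / k * Real.exp (-k * s) := fun s => by positivity
  have hcross : ∀ {s t}, 0 ≤ s → 0 ≤ t →
      f t - A / k * Real.exp (-k * t) ≤ f s + A / k * Real.exp (-k * s) := fun {s t} hs ht => by
    have h1 := hlow ht (le_max_right s t)
    have h2 := hupp hs (le_max_left s t)
    have h3 := hpos (max s t)
    linarith
  set S := (fun s => f s - A / k * Real.exp (-k * s)) '' Set.Ici 0 with hS
  have hbdd : ∀ s, 0 ≤ s → f s + A / k * Real.exp (-k * s) ∈ upperBounds S := by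
    rintro s hs _ ⟨t, ht, rfl⟩
    exact hcross hs ht
  refine ⟨sSup S, fun s hs => abs_le.2 ⟨?_, ?_⟩⟩
  · have := csSup_le (Set.Nonempty.image _ ⟨0, Set.mem_Ici.2 le_rfl⟩) (hbdd s hs)
    linarith
  · have := le_csSup ⟨_, hbdd s hs⟩ (Set.mem_image_of_mem _ (Set.mem_Ici.2 hs))
    linarith

theorem IsGeodesic.comp_add_const {a : Fin n → ℝ} {g : ℝ → EuclideanSpace ℝ (Fin n)}
    (hg : IsGeodesic a g) (L : ℝ) : IsGeodesic a fun s => g (s + L) := by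
  have h1 : deriv (fun s => g (s + L)) = fun s => deriv g (s + L) :=
    funext fun s => deriv_comp_add_const _ _ _
  obtain ⟨lam, hlam⟩ := hg.normal_acceleration
  refine ⟨hg.contDiff.comp (by fun_prop), fun s => hg.mem_quadric _, fun s => ?_,
    fun s => lam (s + L), fun s k => ?_⟩
  · rw [h1]; exact hg.unit_speed _
  · rw [h1, deriv_comp_add_const]; exact hlam _ _

theorem IsGeodesic.dist_le {a : Fin n → ℝ} {g : ℝ → EuclideanSpace ℝ (Fin n)}
    (hg : IsGeodesic a g) (s t : ℝ) : dist (g s) (g t) ≤ |s - t| := by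
  have : LipschitzWith 1 g := lipschitzWith_of_nnnorm_deriv_le
    (hg.contDiff.differentiable two_ne_zero) fun s => by
      rw [← NNReal.coe_le_coe]
      simp [hg.unit_speed]
  simpa [Real.dist_eq] using this.dist_le_mul s t

theorem norm_toLp_le {v : Fin n → ℝ} {δ : ℝ} (hδ : 0 ≤ δ) (hv : ∀ j, |v j| ≤ δ) :
    ‖WithLp.toLp 2 v‖ ≤ (n + 1) * δ := by
  rw [EuclideanSpace.norm_eq, Real.sqrt_le_iff]
  refine ⟨by positivity, ?_⟩
  calc ∑ j, ‖v j‖ ^ 2 ≤ ∑ _j : Fin n, δ ^ 2 := Finset.sum_le_sum fun j _ => by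
        have := hv j
        rw [Real.norm_eq_abs]
        gcongr
    _ = n * δ ^ 2 := by simp
    _ ≤ ((n + 1) * δ) ^ 2 := by
        have : (0 : ℝ) ≤ n := n.cast_nonneg
        nlinarith [sq_nonneg δ]

namespace SplitGeodesic

variable {α : ℝ} {a : Fin n → ℝ} {x₀ y₀ lam : ℝ → ℝ} {X Y : ℝ → Fin n → ℝ}

/-- The tangent lines of a geodesic with vanishing first integral meet the hyperplane `x₀ = 0` in
points of the focal ellipsoid. -/
theorem focalMotion (h : SplitGeodesic α a x₀ y₀ lam X Y) (hα : 0 < α) (ha : ∀ j, 0 < a j)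
    (hF : ∀ s, splitIntegral α a (x₀ s) (y₀ s) (X s) (Y s) = 0)
    (hx : ∀ s, 0 < x₀ s) (hy : ∀ s, y₀ s < 0) :
    FocalMotion α a (fun s => x₀ s / y₀ s) (fun s => x₀ s / y₀ s * lam s / α)
      (fun s j => X s j - x₀ s / y₀ s * Y s j)
      (fun s j => x₀ s / y₀ s * Y s j + α * (X s j / a j)) := by
  have hm : ∀ s, HasDerivAt (fun s => x₀ s / y₀ s)
      ((y₀ s * y₀ s - x₀ s * (lam s * x₀ s / α)) / y₀ s ^ 2) s :=
    fun s => (h.hx₀ s).div (h.hy₀ s) (hy s).ne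
  -- Here p_j = -w_j/y₀, so this is F₀ = 0 divided by y₀².
  have hfocal : ∀ s, ∑ j, (X s j - x₀ s / y₀ s * Y s j) ^ 2 / (a j + α) = 1 := fun s => by
    have h1 := hF s
    rw [splitIntegral, sub_eq_zero] at h1
    have h2 := (hy s).ne
    calc ∑ j, (X s j - x₀ s / y₀ s * Y s j) ^ 2 / (a j + α)
        = (∑ j, (x₀ s * Y s j - X s j * y₀ s) ^ 2 / (a j + α)) / y₀ s ^ 2 := by
          rw [Finset.sum_div]
          refine Finset.sum_congr rfl fun j _ => ?_
          have := (add_pos (ha j) hα).ne'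
          field_simp
          ring
      _ = 1 := by rw [← h1, div_self (by positivity)]
  refine ⟨fun s j => ?_, fun s j => ?_, hfocal, fun s => ?_, fun s => ?_,
    fun s => div_neg_of_pos_of_neg (hx s) (hy s), ?_⟩
  · refine ((h.hX s j).sub ((hm s).mul (h.hY s j))).congr_deriv ?_
    have h1 := (hy s).ne
    have h2 := (ha j).ne'
    field_simp
    ring
  · refine (((hm s).mul (h.hY s j)).add (((h.hX s j).div_const _).const_mul α)).congr_deriv ?_
    have h1 := (hy s).ne
    have h2 := (ha j).ne'
    have h3 := (hx s).ne'
    field_simp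
    ring
  · have e : ∑ j, (X s j - x₀ s / y₀ s * Y s j) *
        (x₀ s / y₀ s * Y s j + α * (X s j / a j)) / (a j + α) =
        ∑ j, X s j ^ 2 / a j - x₀ s / y₀ s * ∑ j, X s j * Y s j / a j -
          ∑ j, (X s j - x₀ s / y₀ s * Y s j) ^ 2 / (a j + α) := by
      simp only [Finset.mul_sum, ← Finset.sum_sub_distrib]
      refine Finset.sum_congr rfl fun j _ => ?_
      have h1 := (hy s).ne
      have h2 := (ha j).ne'
      have h3 := (add_pos (ha j) hα).ne'
      field_simp
      ring
    rw [e, hfocal, h.quadric, h.tangent]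
    have h1 := (hy s).ne
    field_simp
    ring
  -- If u = 0, pairing with BX equates x₀²/α > 0 with -α∑ X_j²/a_j² ≤ 0.
  · by_contra! h0
    have h1 : x₀ s / y₀ s * ∑ j, X s j * Y s j / a j = -(α * ∑ j, X s j ^ 2 / a j ^ 2) := by
      rw [Finset.mul_sum, Finset.mul_sum, ← Finset.sum_neg_distrib]
      refine Finset.sum_congr rfl fun j _ => ?_
      linear_combination X s j / a j * h0 j
    have h2 : 0 ≤ ∑ j, X s j ^ 2 / a j ^ 2 := Finset.sum_nonneg fun j _ => by positivity
    rw [h.tangent] at h1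
    have h3 : x₀ s / y₀ s * (x₀ s * y₀ s / α) = x₀ s ^ 2 / α := by
      have := (hy s).ne
      field_simp
    rw [h3] at h1
    have h4 : 0 < x₀ s ^ 2 / α := by have := hx s; positivity
    nlinarith
  · exact continuous_iff_continuousAt.2 fun s => (hm s).continuousAt

/-- Upper bound for the normal curvature in terms of the first integral. -/
theorem curvature_le_of_le (h : SplitGeodesic α a x₀ y₀ lam X Y) (hα : 0 < α) (ha : ∀ j, 0 < a j)
    {c : ℝ} (hc0 : 0 < c) (hc : ∀ j, c ≤ a j) (s : ℝ) :
    x₀ s ^ 2 * (lam s * splitNormalSq α a (x₀ s) (X s)) ≤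
      α / c * y₀ s ^ 2 - (1 + α / c) * splitIntegral α a (x₀ s) (y₀ s) (X s) (Y s) := by
  have key : ∑ j, (x₀ s * Y s j - X s j * y₀ s) ^ 2 / a j ≤
      (1 + α / c) * ∑ j, (x₀ s * Y s j - X s j * y₀ s) ^ 2 / (a j + α) := by
    rw [Finset.mul_sum]
    refine Finset.sum_le_sum fun j _ => ?_
    have h1 : α / a j ≤ α / c := div_le_div_of_nonneg_left hα.le hc0 (hc j)
    have h2 := add_pos (ha j) hα
    have e : (x₀ s * Y s j - X s j * y₀ s) ^ 2 / a j =
        (1 + α / a j) * ((x₀ s * Y s j - X s j * y₀ s) ^ 2 / (a j + α)) := by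
      have := (ha j).ne'
      field_simp
    rw [e]
    gcongr
  rw [h.sum_wronskian_sq] at key
  rw [splitIntegral]
  linarith

/-- With vanishing first integral the curvature keeps a definite sign. -/
theorem lam_pos_of_zero (h : SplitGeodesic α a x₀ y₀ lam X Y) (hα : 0 < α) (ha : ∀ j, 0 < a j)
    (hF : ∀ s, splitIntegral α a (x₀ s) (y₀ s) (X s) (Y s) = 0) {s : ℝ} (hy : y₀ s ≠ 0) :
    0 < lam s := by
  obtain ⟨c, C, hc0, hC0, hc, hC⟩ := exists_bounds ha
  have h1 := h.le_curvature hα ha hC s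
  rw [hF, mul_zero, sub_zero] at h1
  have h2 : 0 < α / C * y₀ s ^ 2 := by positivity
  have h3 := h.splitNormalSq_pos hα s
  have h4 := pos_of_mul_pos_right (h2.trans_le h1) (sq_nonneg _)
  exact pos_of_mul_pos_left h4 h3.le

/-- As λ > 0, x₀ is convex, so backwards in time it grows at least with slope -y₀(0). -/
theorem tendsto_atBot_of_zero (h : SplitGeodesic α a x₀ y₀ lam X Y) (hα : 0 < α)
    (ha : ∀ j, 0 < a j) (hF : ∀ s, splitIntegral α a (x₀ s) (y₀ s) (X s) (Y s) = 0)
    (hx : ∀ s, 0 < x₀ s) (hy : ∀ s, y₀ s < 0) : Tendsto x₀ atBot atTop := by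
  have hmono : ∀ s, 0 ≤ s → -y₀ 0 ≤ -y₀ (-s) := fun s hs => by
    have := add_mul_le_of_le_hasDerivAt (c := 0) h.hy₀ (fun s _ => by
      have := h.lam_pos_of_zero hα ha hF (hy s).ne
      have := hx s
      positivity) (neg_nonpos.2 hs)
    linarith
  have := tendsto_atTop_of_le_hasDerivAt h.reverse.hx₀ (neg_pos.2 (hy 0)) hmono
  simpa [Function.comp_def] using this.comp tendsto_neg_atBot_atTop

/-- For s ≥ 0 the height x₀ is bounded, hence N ≤ Q, and Joachimsthal's constant J = λN² gives λN ≥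
J/Q. The upper curvature bound then reads y₀² ≥ (c/α)(J/Q)x₀². -/
theorem exists_exp_decay (h : SplitGeodesic α a x₀ y₀ lam X Y) (hα : 0 < α) (ha : ∀ j, 0 < a j)
    (hF : ∀ s, splitIntegral α a (x₀ s) (y₀ s) (X s) (Y s) = 0)
    (hx : ∀ s, 0 < x₀ s) (hy : ∀ s, y₀ s < 0) :
    ∃ κ, 0 < κ ∧ (∀ s, 0 ≤ s → κ * x₀ s ≤ -y₀ s) ∧
      ∀ s, 0 ≤ s → x₀ s ≤ x₀ 0 * Real.exp (-κ * s) := by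
  obtain ⟨c, C, hc0, hC0, hc, hC⟩ := exists_bounds ha
  have hle : ∀ s, 0 ≤ s → x₀ s ≤ x₀ 0 := fun s hs => by
    have := add_mul_le_of_le_hasDerivAt (c := 0) (fun s => (h.hx₀ s).neg)
      (fun s _ => neg_nonneg.2 (hy s).le) hs
    simp only [Pi.neg_apply] at this
    linarith
  set Q := x₀ 0 ^ 2 / α ^ 2 + (1 + x₀ 0 ^ 2 / α) / c with hQ
  have hQ0 : 0 < Q := by positivity
  have hq : ∀ s, 0 ≤ s → splitNormalSq α a (x₀ s) (X s) ≤ Q := fun s hs => by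
    refine (h.splitNormalSq_le ha hc0 hc s).trans ?_
    have := hle s hs
    have := (hx s).le
    rw [hQ]
    gcongr
  set J := lam 0 * splitNormalSq α a (x₀ 0) (X 0) ^ 2 with hJ
  have hJ0 : 0 < J := mul_pos (h.lam_pos_of_zero hα ha hF (hy 0).ne)
    (pow_pos (h.splitNormalSq_pos hα 0) 2)
  have hκ : 0 < c / α * (J / Q) := by positivity
  have hlow : ∀ s, 0 ≤ s → √(c / α * (J / Q)) * x₀ s ≤ -y₀ s := fun s hs => by
    have h1 := h.curvature_le_of_le hα ha hc0 hc s
    rw [hF, mul_zero, sub_zero] at h1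
    have h2 := h.splitNormalSq_pos hα s
    have h3 : J / Q ≤ lam s * splitNormalSq α a (x₀ s) (X s) := by
      rw [div_le_iff₀ hQ0, hJ, h.joachimsthal 0 s]
      have := h.lam_pos_of_zero hα ha hF (hy s).ne
      rw [pow_two, ← mul_assoc]
      exact mul_le_mul_of_nonneg_left (hq s hs) (by positivity)
    have h4 : c / α * (J / Q) * x₀ s ^ 2 ≤ y₀ s ^ 2 := by
      calc c / α * (J / Q) * x₀ s ^ 2 = c / α * (x₀ s ^ 2 * (J / Q)) := by ring
        _ ≤ c / α * (α / c * y₀ s ^ 2) := by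
          refine mul_le_mul_of_nonneg_left (le_trans ?_ h1) (by positivity)
          exact mul_le_mul_of_nonneg_left h3 (sq_nonneg _)
        _ = y₀ s ^ 2 := by field_simp
    refine (abs_le_of_sq_le_sq' ?_ (neg_nonneg.2 (hy s).le)).2
    rw [mul_pow, Real.sq_sqrt hκ.le, neg_sq]
    exact h4
  refine ⟨√(c / α * (J / Q)), Real.sqrt_pos.2 hκ, hlow, fun s hs => ?_⟩
  have := le_mul_exp_of_hasDerivAt_le (k := -√(c / α * (J / Q))) h.hx₀
    (fun s hs => by linarith [hlow s hs]) hs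
  simpa using this

/-- The curve of contact points is close to the geodesic. -/
theorem focalCoeff_bound (h : SplitGeodesic α a x₀ y₀ lam X Y) (hα : 0 < α) (ha : ∀ j, 0 < a j)
    (hF : ∀ s, splitIntegral α a (x₀ s) (y₀ s) (X s) (Y s) = 0)
    (hx : ∀ s, 0 < x₀ s) (hy : ∀ s, y₀ s < 0) {C : ℝ} (hC0 : 0 < C) (hC : ∀ j, a j ≤ C) (s : ℝ) :
    0 ≤ 1 - focalCoeff α a (fun j => X s j - x₀ s / y₀ s * Y s j)
        (fun j => x₀ s / y₀ s * Y s j + α * (X s j / a j)) ∧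
      1 - focalCoeff α a (fun j => X s j - x₀ s / y₀ s * Y s j)
        (fun j => x₀ s / y₀ s * Y s j + α * (X s j / a j)) ≤ (C + α) / α ^ 2 * x₀ s ^ 2 := by
  have hf := h.focalMotion hα ha hF hx hy
  obtain ⟨hβ0, hβ, -⟩ := hf.focalCoeff_spec hα ha s
  have hT0 := hf.sum_u_sq_pos hα ha s
  have hfoc := hf.focal s
  set p : Fin n → ℝ := fun j => X s j - x₀ s / y₀ s * Y s j with hp
  set u : Fin n → ℝ := fun j => x₀ s / y₀ s * Y s j + α * (X s j / a j) with hu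
  change 0 < focalCoeff α a p u at hβ0
  change (∑ j, a j * u j ^ 2 / (a j + α) ^ 2) * focalCoeff α a p u ^ 2 +
    2 * (∑ j, a j * (p j * u j) / (a j + α) ^ 2) * focalCoeff α a p u =
      α * ∑ j, p j ^ 2 / (a j + α) ^ 2 at hβ
  change 0 < ∑ j, a j * u j ^ 2 / (a j + α) ^ 2 at hT0
  change ∑ j, p j ^ 2 / (a j + α) = 1 at hfoc
  -- The point X is the case β = 1 of the contact formula, but it misses the neck ellipsoid by
  -- x₀²/α.
  have hone : ∑ j, X s j ^ 2 / a j = ∑ j, p j ^ 2 / (a j + α) -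
      α * ∑ j, p j ^ 2 / (a j + α) ^ 2 + ∑ j, a j * u j ^ 2 / (a j + α) ^ 2 +
      2 * ∑ j, a j * (p j * u j) / (a j + α) ^ 2 := by
    simp only [Finset.mul_sum, ← Finset.sum_add_distrib, ← Finset.sum_sub_distrib]
    refine Finset.sum_congr rfl fun j _ => ?_
    have e1 : X s j = a j / (a j + α) * (p j + u j) := by
      have h1 := (ha j).ne'
      have h2 := (add_pos (ha j) hα).ne'
      rw [hp, hu]
      field_simp
      ring
    have h1 := (ha j).ne'
    have h2 := (add_pos (ha j) hα).ne'
    rw [e1]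
    field_simp
    ring
  rw [h.quadric, hfoc] at hone
  have hS : 1 / (C + α) ≤ ∑ j, p j ^ 2 / (a j + α) ^ 2 := by
    rw [← hfoc, Finset.sum_div]
    refine Finset.sum_le_sum fun j _ => ?_
    rw [div_div]
    have := add_pos (ha j) hα
    refine div_le_div_of_nonneg_left (sq_nonneg _) (by positivity) ?_
    nlinarith [hC j]
  set β := focalCoeff α a p u
  set S := ∑ j, p j ^ 2 / (a j + α) ^ 2
  set R := ∑ j, a j * (p j * u j) / (a j + α) ^ 2
  set T := ∑ j, a j * u j ^ 2 / (a j + α) ^ 2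
  have hS0 : 0 < S := lt_of_lt_of_le (by positivity) hS
  have hx2 : 0 < x₀ s ^ 2 / α := by have := hx s; positivity
  -- Difference of the values of Tt² + 2Rt at t = 1 and at t = β.
  have hprod : (1 - β) * (2 * R + T + T * β) = x₀ s ^ 2 / α := by linear_combination -hone - hβ
  have hfac : α * S ≤ 2 * R + T + T * β := by nlinarith [mul_pos hT0 hβ0]
  have hfac0 : 0 < 2 * R + T + T * β := lt_of_lt_of_le (by positivity) hfac
  have hε : 0 ≤ 1 - β := (pos_of_mul_pos_left (hprod ▸ hx2) hfac0.le).le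
  refine ⟨hε, ?_⟩
  have h1 : (1 - β) * (α * (1 / (C + α))) ≤ x₀ s ^ 2 / α := by
    rw [← hprod]
    refine mul_le_mul_of_nonneg_left (le_trans ?_ hfac) hε
    gcongr
  calc 1 - β = (C + α) / α * ((1 - β) * (α * (1 / (C + α)))) := by field_simp
    _ ≤ (C + α) / α * (x₀ s ^ 2 / α) := by gcongr
    _ = (C + α) / α ^ 2 * x₀ s ^ 2 := by field_simp

/-- The contact points and their speed, compared with the geodesic. -/
theorem exists_contact_estimate (h : SplitGeodesic α a x₀ y₀ lam X Y) (hα : 0 < α)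
    (ha : ∀ j, 0 < a j) (hF : ∀ s, splitIntegral α a (x₀ s) (y₀ s) (X s) (Y s) = 0)
    (hx : ∀ s, 0 < x₀ s) (hy : ∀ s, y₀ s < 0) :
    ∃ (m σ : ℝ → ℝ) (p u : ℝ → Fin n → ℝ), FocalMotion α a m σ p u ∧ ∃ A B κ : ℝ,
      0 < A ∧ 0 < B ∧ 0 < κ ∧ ∀ s, 0 ≤ s → x₀ s ≤ x₀ 0 * Real.exp (-κ * s) ∧
        ‖WithLp.toLp 2 (X s) - WithLp.toLp 2 (contactPoint α a (p s) (u s))‖ ≤ B * x₀ s ^ 2 ∧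
        |FocalMotion.contactSpeed α a (m s) (p s) (u s) - 1| ≤ A * x₀ s ^ 2 := by
  obtain ⟨c, C, hc0, hC0, hc, hC⟩ := exists_bounds ha
  obtain ⟨K, hK0, hK⟩ := h.exists_sq_le_of_zero hα ha hF
  obtain ⟨κ, hκ0, hκ, hdecay⟩ := h.exists_exp_decay hα ha hF hx hy
  have hf := h.focalMotion hα ha hF hx hy
  have hβb := h.focalCoeff_bound hα ha hF hx hy hC0 hC
  set m : ℝ → ℝ := fun s => x₀ s / y₀ s with hm
  set p : ℝ → Fin n → ℝ := fun s j => X s j - x₀ s / y₀ s * Y s j with hp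
  set u : ℝ → Fin n → ℝ := fun s j => x₀ s / y₀ s * Y s j + α * (X s j / a j) with hu
  set E := (C + α) / α ^ 2 with hE
  have hE0 : 0 < E := by positivity
  set M := C * (1 + x₀ 0 ^ 2 / α) with hM
  -- `D` bounds |u_j|: |x₀/y₀| ≤ 1/κ, |Y_j| ≤ 1, and X_j² ≤ M gives |X_j| ≤ 1 + M.
  set D := 1 / κ + α * ((1 + M) / c) with hD
  have hD0 : 0 < D := by positivity
  have hle : ∀ s, 0 ≤ s → x₀ s ≤ x₀ 0 := fun s hs => (hdecay s hs).trans (by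
    have h1 : Real.exp (-κ * s) ≤ 1 := Real.exp_le_one_iff.2 (by nlinarith)
    nlinarith [hx 0])
  have hyabs : ∀ s, -y₀ s ≤ K * x₀ s := fun s => by
    refine (abs_le_of_sq_le_sq' (?_ : (-y₀ s) ^ 2 ≤ (K * x₀ s) ^ 2)
      (mul_pos hK0 (hx s)).le).2
    rw [neg_sq, mul_pow]
    exact hK s
  have hYle : ∀ s j, |Y s j| ≤ 1 := fun s j => by
    have h1 := Finset.single_le_sum (f := fun j => Y s j ^ 2) (fun i _ => sq_nonneg _)
      (Finset.mem_univ j)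
    rw [← sq_le_one_iff_abs_le_one]
    nlinarith [h.speed s, sq_nonneg (y₀ s)]
  have hXle : ∀ s, 0 ≤ s → ∀ j, |X s j| ≤ 1 + M := fun s hs j => by
    have h1 := Finset.single_le_sum (f := fun j => X s j ^ 2 / a j)
      (fun i _ => div_nonneg (sq_nonneg _) (ha i).le) (Finset.mem_univ j)
    rw [h.quadric] at h1
    have h2 : X s j ^ 2 ≤ M := by
      rw [div_le_iff₀ (ha j)] at h1
      refine h1.trans ?_
      rw [hM, mul_comm]
      have h3 := hle s hs
      have h4 := (hx s).le
      have h5 := hC j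
      have h6 := (ha j).le
      gcongr
    nlinarith [sq_abs (X s j), abs_nonneg (X s j)]
  have hule : ∀ s, 0 ≤ s → ∀ j, |u s j| ≤ D := fun s hs j => by
    have h1 : |x₀ s / y₀ s| ≤ 1 / κ := by
      rw [abs_div, abs_of_pos (hx s), abs_of_neg (hy s), div_le_div_iff₀ (neg_pos.2 (hy s)) hκ0]
      linarith [hκ s hs]
    have h2 : |X s j / a j| ≤ (1 + M) / c := by
      rw [abs_div, abs_of_pos (ha j)]
      exact div_le_div₀ (by positivity) (hXle s hs j) hc0 (hc j)
    calc |u s j| ≤ |x₀ s / y₀ s * Y s j| + |α * (X s j / a j)| := abs_add_le _ _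
      _ = |x₀ s / y₀ s| * |Y s j| + α * |X s j / a j| := by
        rw [abs_mul, abs_mul, abs_of_pos hα]
      _ ≤ 1 / κ * 1 + α * ((1 + M) / c) := by
        have := hYle s j
        gcongr
      _ = D := by rw [mul_one]
  have hclose : ∀ s, 0 ≤ s → ‖WithLp.toLp 2 (X s) - WithLp.toLp 2 (contactPoint α a (p s) (u s))‖ ≤
      (n + 1) * (E * D) * x₀ s ^ 2 := fun s hs => by
    have : ∀ j, |X s j - contactPoint α a (p s) (u s) j| ≤ E * D * x₀ s ^ 2 := fun j => by
      have e : X s j - contactPoint α a (p s) (u s) j =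
          a j / (a j + α) * ((1 - focalCoeff α a (p s) (u s)) * u s j) := by
        have h1 := (ha j).ne'
        have h2 := (add_pos (ha j) hα).ne'
        have e1 : X s j = a j / (a j + α) * (p s j + u s j) := by
          simp only [hp, hu]
          field_simp
          ring
        rw [contactPoint]
        nth_rw 1 [e1]
        ring
      have h1 : a j / (a j + α) ≤ 1 := div_le_one_of_le₀ (by linarith) (add_pos (ha j) hα).le
      have h2 : 0 ≤ a j / (a j + α) := div_nonneg (ha j).le (add_pos (ha j) hα).le
      obtain ⟨h3, h4⟩ := hβb s
      change 0 ≤ 1 - focalCoeff α a (p s) (u s) at h3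
      change 1 - focalCoeff α a (p s) (u s) ≤ E * x₀ s ^ 2 at h4
      rw [e, abs_mul, abs_mul, abs_of_nonneg h2, abs_of_nonneg h3]
      calc a j / (a j + α) * ((1 - focalCoeff α a (p s) (u s)) * |u s j|)
          ≤ 1 * (E * x₀ s ^ 2 * D) := by
            have := hule s hs j
            gcongr
        _ = E * D * x₀ s ^ 2 := by ring
    have h5 := norm_toLp_le (v := fun j => X s j - contactPoint α a (p s) (u s) j)
      (by positivity) this
    rw [mul_assoc]
    exact h5
  set A := K * ((n + 1) * (E * D)) + K ^ 2 + E with hA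
  have hA0 : 0 < A := by positivity
  have hv : ∀ s, 0 ≤ s → |FocalMotion.contactSpeed α a (m s) (p s) (u s) - 1| ≤ A * x₀ s ^ 2 :=
    fun s hs => by
    obtain ⟨h3, h4⟩ := hβb s
    change 0 ≤ 1 - focalCoeff α a (p s) (u s) at h3
    change 1 - focalCoeff α a (p s) (u s) ≤ E * x₀ s ^ 2 at h4
    have hβ0 := (hf.focalCoeff_spec hα ha s).1
    change 0 < focalCoeff α a (p s) (u s) at hβ0
    set β := focalCoeff α a (p s) (u s)
    set N := FocalMotion.contactDist α a (p s) (u s)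
    -- The speed is βrN. Since p - γ = (X - γ) - (x₀/y₀)Y, rN differs from |Y| by at most r|X - γ|,
    -- with r ≤ K and |Y|² = 1 - y₀².
    set r := -y₀ s / x₀ s with hr
    have hr0 : 0 < r := div_pos (neg_pos.2 (hy s)) (hx s)
    have hrK : r ≤ K := (div_le_iff₀ (hx s)).2 (hyabs s)
    have hspeed : FocalMotion.contactSpeed α a (m s) (p s) (u s) = β * (r * N) := by
      have h1 := (hx s).ne'
      have h2 := (hy s).ne
      change -(β / (x₀ s / y₀ s)) * N = β * (-y₀ s / x₀ s * N)
      field_simp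
    have hY2 : ‖WithLp.toLp 2 (Y s)‖ ^ 2 = 1 - y₀ s ^ 2 := by
      rw [EuclideanSpace.real_norm_sq_eq]
      linarith [h.speed s]
    have hY0 := norm_nonneg (WithLp.toLp 2 (Y s))
    have hY1 : ‖WithLp.toLp 2 (Y s)‖ ≤ 1 := by nlinarith [sq_nonneg (y₀ s)]
    have hN : N = ‖(WithLp.toLp 2 (X s) - WithLp.toLp 2 (contactPoint α a (p s) (u s))) -
        (x₀ s / y₀ s) • WithLp.toLp 2 (Y s)‖ := by
      rw [EuclideanSpace.norm_eq]
      refine congrArg Real.sqrt (Finset.sum_congr rfl fun j _ => ?_)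
      rw [Real.norm_eq_abs, sq_abs]
      simp only [PiLp.sub_apply, PiLp.smul_apply, smul_eq_mul, hp]
      ring
    have hNd : |N - -(x₀ s / y₀ s) * ‖WithLp.toLp 2 (Y s)‖| ≤ (n + 1) * (E * D) * x₀ s ^ 2 := by
      refine le_trans ?_ (hclose s hs)
      have h1 := abs_norm_sub_norm_le
        ((WithLp.toLp 2 (X s) - WithLp.toLp 2 (contactPoint α a (p s) (u s))) -
          (x₀ s / y₀ s) • WithLp.toLp 2 (Y s)) (-((x₀ s / y₀ s) • WithLp.toLp 2 (Y s)))
      rw [← hN, norm_neg, norm_smul, Real.norm_eq_abs,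
        abs_of_neg (div_neg_of_pos_of_neg (hx s) (hy s)), sub_neg_eq_add, sub_add_cancel] at h1
      exact h1
    have hrN : |r * N - ‖WithLp.toLp 2 (Y s)‖| ≤ K * ((n + 1) * (E * D) * x₀ s ^ 2) := by
      have e : r * N - ‖WithLp.toLp 2 (Y s)‖ =
          r * (N - -(x₀ s / y₀ s) * ‖WithLp.toLp 2 (Y s)‖) := by
        have h1 := (hx s).ne'
        have h2 := (hy s).ne
        rw [hr]
        field_simp
        ring
      rw [e, abs_mul, abs_of_pos hr0]
      gcongr
    have hyK := hK s
    have hrN1 : |r * N - 1| ≤ (K * ((n + 1) * (E * D)) + K ^ 2) * x₀ s ^ 2 := by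
      have h1 : |‖WithLp.toLp 2 (Y s)‖ - 1| ≤ y₀ s ^ 2 := by
        rw [abs_le]
        constructor <;> nlinarith
      calc |r * N - 1| ≤ |r * N - ‖WithLp.toLp 2 (Y s)‖| + |‖WithLp.toLp 2 (Y s)‖ - 1| :=
            abs_sub_le _ _ _
        _ ≤ K * ((n + 1) * (E * D) * x₀ s ^ 2) + K ^ 2 * x₀ s ^ 2 :=
            add_le_add hrN (h1.trans hyK)
        _ = _ := by ring
    rw [hspeed]
    calc |β * (r * N) - 1| = |β * (r * N - 1) + -(1 - β)| := by congr 1; ring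
      _ ≤ |β * (r * N - 1)| + |-(1 - β)| := abs_add_le _ _
      _ = β * |r * N - 1| + (1 - β) := by rw [abs_neg, abs_mul, abs_of_pos hβ0, abs_of_nonneg h3]
      _ ≤ 1 * |r * N - 1| + (1 - β) := by
        have : β ≤ 1 := by linarith
        gcongr
      _ ≤ (K * ((n + 1) * (E * D)) + K ^ 2) * x₀ s ^ 2 + E * x₀ s ^ 2 := by
        rw [one_mul]
        exact add_le_add hrN1 h4
      _ = A * x₀ s ^ 2 := by rw [hA]; ring
  exact ⟨m, _, p, u, hf, A, _, κ, hA0, by positivity, hκ0,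
    fun s hs => ⟨hdecay s hs, hclose s hs, hv s hs⟩⟩

/-- A geodesic with vanishing first integral that descends towards the neck approaches a geodesic
of the neck ellipsoid exponentially fast. -/
theorem exists_asymptotic_geodesic (h : SplitGeodesic α a x₀ y₀ lam X Y) (hα : 0 < α)
    (ha : ∀ j, 0 < a j) (hF : ∀ s, splitIntegral α a (x₀ s) (y₀ s) (X s) (Y s) = 0)
    (hx : ∀ s, 0 < x₀ s) (hy : ∀ s, y₀ s < 0) :
    ∃ g : ℝ → EuclideanSpace ℝ (Fin n), IsGeodesic a g ∧ ∃ D κ : ℝ, 0 < κ ∧ ∀ s, 0 ≤ s →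
      |x₀ s| + dist (WithLp.toLp 2 (X s)) (g s) ≤ D * Real.exp (-κ * s) := by
  obtain ⟨m, σ, p, u, hf, A, B, κ, hA0, hB0, hκ0, hest⟩ := h.exists_contact_estimate hα ha hF hx hy
  have hx2 : ∀ s, 0 ≤ s → x₀ s ^ 2 ≤ x₀ 0 ^ 2 * Real.exp (-(2 * κ) * s) := fun s hs => by
    have h1 := pow_le_pow_left₀ (hx s).le (hest s hs).1 2
    rw [mul_pow, ← Real.exp_nat_mul] at h1
    refine h1.trans_eq ?_
    congr 2
    push_cast
    ring
  have hvc := hf.continuous_contactSpeed hα ha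
  obtain ⟨g, hg, hgz⟩ := exists_isGeodesic_of_time_change ha (hf.contactElement_mem hα ha) hvc
    (hf.hasDerivAt_contactElement hα ha)
  set v : ℝ → ℝ := fun s => FocalMotion.contactSpeed α a (m s) (p s) (u s)
  -- Arc length of the contact curve minus `s`; its limit `L` is the phase shift of the asymptotic
  -- geodesic.
  have hτ : ∀ s, HasDerivAt (fun s => (∫ t in (0 : ℝ)..s, v t) - s) (v s - 1) s := fun s =>
    (intervalIntegral.integral_hasDerivAt_right (hvc.intervalIntegrable _ _)
      (hvc.stronglyMeasurableAtFilter _ _) hvc.continuousAt).sub (hasDerivAt_id s)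
  obtain ⟨L, hL⟩ := exists_limit_of_abs_deriv_le_exp (A := A * x₀ 0 ^ 2) (k := 2 * κ)
    (by positivity) hτ fun s hs => by
      refine (hest s hs).2.2.trans ?_
      rw [mul_assoc]
      exact mul_le_mul_of_nonneg_left (hx2 s hs) hA0.le
  refine ⟨fun s => g (s + L), hg.comp_add_const L,
    x₀ 0 + B * x₀ 0 ^ 2 + A * x₀ 0 ^ 2 / (2 * κ), κ, hκ0, fun s hs => ?_⟩
  have hexp : Real.exp (-(2 * κ) * s) ≤ Real.exp (-κ * s) := Real.exp_le_exp.2 (by nlinarith)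
  have d1 : dist (WithLp.toLp 2 (X s)) (WithLp.toLp 2 (contactPoint α a (p s) (u s))) ≤
      B * x₀ 0 ^ 2 * Real.exp (-κ * s) := by
    rw [dist_eq_norm, mul_assoc B]
    refine (hest s hs).2.1.trans (mul_le_mul_of_nonneg_left ?_ hB0.le)
    exact (hx2 s hs).trans (mul_le_mul_of_nonneg_left hexp (sq_nonneg _))
  have d2 : dist (WithLp.toLp 2 (contactPoint α a (p s) (u s))) (g (s + L)) ≤
      A * x₀ 0 ^ 2 / (2 * κ) * Real.exp (-κ * s) := by
    have e : WithLp.toLp 2 (contactPoint α a (p s) (u s)) = g (∫ t in (0 : ℝ)..s, v t) := hgz s hs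
    rw [e]
    refine (hg.dist_le _ _).trans ?_
    rw [← sub_sub]
    exact (hL s hs).trans (mul_le_mul_of_nonneg_left hexp (by positivity))
  have d3 := dist_triangle (WithLp.toLp 2 (X s))
    (WithLp.toLp 2 (contactPoint α a (p s) (u s))) (g (s + L))
  rw [abs_of_pos (hx s)]
  have d4 := (hest s hs).1
  linarith

end SplitGeodesic

/-! ### Signs of x₀ and y₀, and passage through the neck -/

theorem pos_or_neg_of_continuous_of_ne_zero {f : ℝ → ℝ} (hf : Continuous f) (h0 : ∀ s, f s ≠ 0) :
    (∀ s, 0 < f s) ∨ ∀ s, f s < 0 := by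
  by_contra! hcon
  obtain ⟨⟨s, hs⟩, t, ht⟩ := hcon
  obtain ⟨r, hr⟩ := mem_range_of_exists_le_of_exists_ge hf ⟨s, hs⟩ ⟨t, ht⟩
  exact h0 r hr

namespace SplitGeodesic

variable {α : ℝ} {a : Fin n → ℝ} {x₀ y₀ lam : ℝ → ℝ} {X Y : ℝ → Fin n → ℝ} {F : ℝ}

theorem continuous_x₀ (h : SplitGeodesic α a x₀ y₀ lam X Y) : Continuous x₀ :=
  continuous_iff_continuousAt.2 fun s => (h.hx₀ s).continuousAt

theorem continuous_y₀ (h : SplitGeodesic α a x₀ y₀ lam X Y) : Continuous y₀ :=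
  continuous_iff_continuousAt.2 fun s => (h.hy₀ s).continuousAt

theorem splitIntegral_le (hα : 0 < α) (ha : ∀ j, 0 < a j) (x₀ y₀ : ℝ) (X Y : Fin n → ℝ) :
    splitIntegral α a x₀ y₀ X Y ≤ y₀ ^ 2 :=
  sub_le_self _ (Finset.sum_nonneg fun j _ => div_nonneg (sq_nonneg _) (add_pos (ha j) hα).le)

theorem splitIntegral_nonneg_of_eq_zero (h : SplitGeodesic α a x₀ y₀ lam X Y) (hα : 0 < α)
    (ha : ∀ j, 0 < a j) {s : ℝ} (hs : x₀ s = 0) :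
    0 ≤ splitIntegral α a (x₀ s) (y₀ s) (X s) (Y s) := by
  have h1 : ∑ j, X s j ^ 2 / (a j + α) ≤ 1 := by
    have h2 := h.quadric s
    rw [hs, zero_pow two_ne_zero, zero_div, add_zero] at h2
    rw [← h2]
    exact Finset.sum_le_sum fun j _ =>
      div_le_div_of_nonneg_left (sq_nonneg _) (ha j) (by linarith)
  have e : ∑ j, (x₀ s * Y s j - X s j * y₀ s) ^ 2 / (a j + α) =
      y₀ s ^ 2 * ∑ j, X s j ^ 2 / (a j + α) := by
    rw [Finset.mul_sum]
    exact Finset.sum_congr rfl fun j _ => by rw [hs]; ring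
  rw [splitIntegral, e]
  nlinarith [sq_nonneg (y₀ s)]

/-- At y₀ = 0 the first integral is -x₀²∑ Y_j²/(a_j + α); its vanishing would give Y = 0, against
unit speed. -/
theorem y₀_ne_zero_of_zero (h : SplitGeodesic α a x₀ y₀ lam X Y) (hα : 0 < α)
    (ha : ∀ j, 0 < a j) {s : ℝ} (hF : splitIntegral α a (x₀ s) (y₀ s) (X s) (Y s) = 0)
    (hx : x₀ s ≠ 0) : y₀ s ≠ 0 := by
  intro hy
  have hpos : ∀ j, 0 < a j + α := fun j => add_pos (ha j) hα
  rw [splitIntegral, hy, zero_pow two_ne_zero, zero_sub, neg_eq_zero,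
    Finset.sum_eq_zero_iff_of_nonneg fun j _ => div_nonneg (sq_nonneg _) (hpos j).le] at hF
  have h1 : ∑ j, Y s j ^ 2 = 0 := Finset.sum_eq_zero fun j hj => by
    have h2 := (div_eq_zero_iff.1 (hF j hj)).resolve_right (hpos j).ne'
    rw [mul_zero, sub_zero, mul_pow] at h2
    exact (mul_eq_zero.1 h2).resolve_left (pow_ne_zero _ hx)
  have h3 := h.speed s
  rw [h1, hy] at h3
  norm_num at h3

/-- A geodesic with positive first integral moving towards positive `x₀`. -/
theorem passes_of_pos (h : SplitGeodesic α a x₀ y₀ lam X Y) (hα : 0 < α) (ha : ∀ j, 0 < a j)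
    (hF : ∀ s, splitIntegral α a (x₀ s) (y₀ s) (X s) (Y s) = F) (hF0 : 0 < F)
    (hy : ∀ s, 0 < y₀ s) :
    Tendsto x₀ atBot atBot ∧ Tendsto x₀ atTop atTop ∧
      ∃ s₀, x₀ s₀ = 0 ∧ (∀ s < s₀, x₀ s < 0) ∧ ∀ s > s₀, 0 < x₀ s := by
  have hlow : ∀ s, √F ≤ y₀ s := fun s =>
    (Real.sqrt_le_left (hy s).le).2 (hF s ▸ splitIntegral_le hα ha _ _ _ _)
  have hF1 := Real.sqrt_pos.2 hF0
  have htop : Tendsto x₀ atTop atTop :=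
    tendsto_atTop_of_le_hasDerivAt (s₁ := 0) h.hx₀ hF1 fun s _ => hlow s
  have hbot : Tendsto x₀ atBot atBot := by
    have h1 := tendsto_atTop_of_le_hasDerivAt (s₁ := 0) h.reverse.neg.hx₀ hF1
      fun s _ => by simpa using hlow (-s)
    have h2 := h1.comp tendsto_neg_atBot_atTop
    simp only [Function.comp_def, neg_neg] at h2
    exact tendsto_neg_atTop_iff.1 h2
  obtain ⟨s₀, hs₀⟩ := h.continuous_x₀.surjective htop hbot 0
  have hmono : StrictMono x₀ := strictMono_of_deriv_pos fun s => by
    rw [(h.hx₀ s).deriv]; exact hy s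
  exact ⟨hbot, htop, s₀, hs₀, fun s hs => hs₀ ▸ hmono hs, fun s hs => hs₀ ▸ hmono hs⟩

end SplitGeodesic

/-! ### Return to Euclidean curves and the main theorem -/

theorem IsGeodesic.split {a : Fin (n + 1) → ℝ} {x : ℝ → EuclideanSpace ℝ (Fin (n + 1))}
    (hx : IsGeodesic a x) (ha : a 0 ≠ 0) :
    ∃ lam, SplitGeodesic (-a 0) (fun j => a j.succ) (fun s => x s 0) (fun s => deriv x s 0) lam
      (fun s j => x s j.succ) (fun s j => deriv x s j.succ) := by
  obtain ⟨lam, hlam⟩ := hx.normal_acceleration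
  have h2 := hx.contDiff
  rw [show (2 : WithTop ℕ∞) = 1 + 1 from rfl, contDiff_succ_iff_deriv] at h2
  have hd : ∀ s k, HasDerivAt (fun t => x t k) (deriv x s k) s := fun s =>
    hasDerivAt_euclidean.1 (h2.1 s).hasDerivAt
  have hdd : ∀ s k, HasDerivAt (fun t => deriv x t k) (-lam s * (x s k / a k)) s := fun s k => by
    rw [← hlam]
    exact hasDerivAt_euclidean.1 (h2.2.2.differentiable one_ne_zero s).hasDerivAt k
  refine ⟨lam, fun s => hd s 0, fun s => (hdd s 0).congr_deriv ?_, fun s j => hd s _,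
    fun s j => hdd s _, fun s => ?_, fun s => ?_⟩
  · field_simp
  · have h3 := hx.mem_quadric s
    rw [Fin.sum_univ_succ] at h3
    rw [div_neg]
    linarith
  · have h3 := EuclideanSpace.real_norm_sq_eq (deriv x s)
    rw [hx.unit_speed, Fin.sum_univ_succ] at h3
    linarith

theorem uhlenbeckDevaney_eq_splitIntegral (a : Fin (n + 1) → ℝ)
    (x y : EuclideanSpace ℝ (Fin (n + 1))) :
    uhlenbeckDevaney a 0 x y =
      splitIntegral (-a 0) (fun j => a j.succ) (x 0) (y 0) (fun j => x j.succ)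
        fun j => y j.succ := by
  rw [uhlenbeckDevaney, splitIntegral, Finset.sum_erase_eq_sub (Finset.mem_univ _),
    Fin.sum_univ_succ, add_sub_cancel_left, sub_eq_add_neg, ← Finset.sum_neg_distrib]
  refine congrArg _ (Finset.sum_congr rfl fun j _ => ?_)
  rw [← div_neg, neg_add, neg_neg, sub_eq_add_neg (a 0), add_comm (a 0)]

theorem dist_hyperplaneIncl_le (z : EuclideanSpace ℝ (Fin (n + 1))) (v : EuclideanSpace ℝ (Fin n)) :
    dist z (hyperplaneIncl v) ≤ |z 0| + dist (WithLp.toLp 2 fun j => z j.succ) v := by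
  rw [EuclideanSpace.dist_eq, Fin.sum_univ_succ, Real.sqrt_le_iff]
  refine ⟨by positivity, ?_⟩
  have h1 : ∑ j : Fin n, dist (z j.succ) (hyperplaneIncl v j.succ) ^ 2 =
      dist (WithLp.toLp 2 fun j => z j.succ) v ^ 2 := by
    rw [EuclideanSpace.dist_eq, Real.sq_sqrt (Finset.sum_nonneg fun j _ => sq_nonneg _)]
    rfl
  have h2 : dist (z 0) (hyperplaneIncl v 0) = |z 0| := by
    rw [Real.dist_eq]
    simp [hyperplaneIncl]
  rw [h1, h2]
  have := mul_nonneg (abs_nonneg (z 0))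
    (dist_nonneg (x := (WithLp.toLp 2 fun j => z j.succ)) (y := v))
  linarith

/-- Only |x₀| has to match, so reflected data serve for a curve on the side x₀ < 0. -/
theorem approachesNeckGeodesic_of_split {a : Fin (n + 1) → ℝ} (ha_neg : a 0 < 0)
    (ha_pos : ∀ j : Fin n, 0 < a j.succ) {z : ℝ → EuclideanSpace ℝ (Fin (n + 1))}
    {x₀ y₀ lam : ℝ → ℝ} {Y : ℝ → Fin n → ℝ}
    (h : SplitGeodesic (-a 0) (fun j => a j.succ) x₀ y₀ lam (fun s j => z s j.succ) Y)
    (hF : ∀ s, splitIntegral (-a 0) (fun j => a j.succ) (x₀ s) (y₀ s) (fun j => z s j.succ) (Y s)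
      = 0)
    (hx : ∀ s, 0 < x₀ s) (hy : ∀ s, y₀ s < 0) (hz : ∀ s, |z s 0| = |x₀ s|) :
    ApproachesNeckGeodesic a z := by
  obtain ⟨g, hg, D, κ, hκ, hle⟩ := h.exists_asymptotic_geodesic (neg_pos.2 ha_neg) ha_pos hF hx hy
  refine ⟨fun s => hyperplaneIncl (g s), ⟨g, hg, fun _ => rfl⟩, D, κ, hκ, fun s hs => ?_⟩
  refine (dist_hyperplaneIncl_le _ _).trans ?_
  rw [hz]
  exact hle s hs

theorem IsGeodesic.isNeckGeodesic {a : Fin (n + 1) → ℝ}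
    {x : ℝ → EuclideanSpace ℝ (Fin (n + 1))} (hx : IsGeodesic a x) (h0 : ∀ s, x s 0 = 0) :
    IsNeckGeodesic a x := by
  obtain ⟨lam, hlam⟩ := hx.normal_acceleration
  have h2 := hx.contDiff
  rw [show (2 : WithTop ℕ∞) = 1 + 1 from rfl, contDiff_succ_iff_deriv] at h2
  have hd : ∀ s k, HasDerivAt (fun t => x t k) (deriv x s k) s := fun s =>
    hasDerivAt_euclidean.1 (h2.1 s).hasDerivAt
  have hdd : ∀ s k, HasDerivAt (fun t => deriv x t k) (deriv (deriv x) s k) s := fun s =>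
    hasDerivAt_euclidean.1 (h2.2.2.differentiable one_ne_zero s).hasDerivAt
  have h1 : deriv (fun s => WithLp.toLp 2 fun j : Fin n => x s j.succ) =
      fun s => WithLp.toLp 2 fun j => deriv x s j.succ := funext fun s =>
    (hasDerivAt_euclidean.2 fun j => hd s j.succ).deriv
  have h3 : deriv (fun s => WithLp.toLp 2 fun j : Fin n => deriv x s j.succ) =
      fun s => WithLp.toLp 2 fun j => deriv (deriv x) s j.succ := funext fun s =>
    (hasDerivAt_euclidean.2 fun j => hdd s j.succ).deriv
  have hy0 : ∀ s, deriv x s 0 = 0 := fun s => by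
    have e : (fun t => x t 0) = fun _ => 0 := funext h0
    exact (e ▸ hd s 0).unique (hasDerivAt_const s 0)
  refine ⟨fun s => WithLp.toLp 2 fun j => x s j.succ, ⟨?_, fun s => ?_, fun s => ?_,
    ⟨lam, fun s k => ?_⟩⟩, fun s => ?_⟩
  · rw [contDiff_euclidean]
    exact fun j => contDiff_euclidean.1 hx.contDiff j.succ
  · have := hx.mem_quadric s
    rw [Fin.sum_univ_succ, h0] at this
    simpa using this
  · have h4 := EuclideanSpace.real_norm_sq_eq (deriv x s)
    rw [hx.unit_speed, Fin.sum_univ_succ, hy0] at h4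
    rw [h1, EuclideanSpace.norm_eq, Real.sqrt_eq_one]
    simp only [Real.norm_eq_abs, sq_abs]
    linarith
  · rw [h1, h3]
    exact hlam s k.succ
  · ext k
    refine Fin.cases ?_ (fun j => ?_) k
    · simp [hyperplaneIncl, h0]
    · simp [hyperplaneIncl]

end HyperboloidGeodesics

open HyperboloidGeodesics in
theorem theorem1p1 (n : ℕ) (a : Fin (n + 1) → ℝ) (ha_neg : a 0 < 0)
    (ha_pos : ∀ j : Fin n, 0 < a j.succ) (ha_mono : StrictMono a)
    (x : ℝ → EuclideanSpace ℝ (Fin (n + 1))) (hx : HyperboloidGeodesics.IsGeodesic a x) :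
    ∃ F₀ : ℝ,
      (∀ s, HyperboloidGeodesics.uhlenbeckDevaney a 0 (x s) (deriv x s) = F₀) ∧
      (HyperboloidGeodesics.CrossesNeck x ↔ 0 < F₀) ∧
      (0 < F₀ → HyperboloidGeodesics.PassesThrough x) ∧
      (F₀ < 0 → HyperboloidGeodesics.IsReflected x) ∧
      (F₀ = 0 →
        HyperboloidGeodesics.IsNeckGeodesic a x ∨
        (Filter.Tendsto (fun s => |x s 0|) Filter.atBot Filter.atTop ∧
          HyperboloidGeodesics.ApproachesNeckGeodesic a x) ∨
        (Filter.Tendsto (fun s => |x s 0|) Filter.atTop Filter.atTop ∧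
          HyperboloidGeodesics.ApproachesNeckGeodesic a (fun s => x (-s)))) := by
  obtain ⟨lam, h⟩ := hx.split ha_neg.ne
  have hα := neg_pos.2 ha_neg
  obtain ⟨F, hFdef⟩ : ∃ F, F = uhlenbeckDevaney a 0 (x 0) (deriv x 0) := ⟨_, rfl⟩
  have hF : ∀ s, splitIntegral (-a 0) (fun j => a j.succ) (x s 0) (deriv x s 0)
      (fun j => x s j.succ) (fun j => deriv x s j.succ) = F := fun s => by
    rw [hFdef, uhlenbeckDevaney_eq_splitIntegral]
    exact h.splitIntegral_const hα ha_pos s 0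
  have hFneg : ∀ s, splitIntegral (-a 0) (fun j => a j.succ) (-x s 0) (-deriv x s 0)
      (fun j => x s j.succ) (fun j => deriv x s j.succ) = F := fun s => by
    rw [SplitGeodesic.splitIntegral_neg, hF]
  have hFrev : ∀ s, splitIntegral (-a 0) (fun j => a j.succ) (x (-s) 0) (-deriv x (-s) 0)
      (fun j => x (-s) j.succ) (fun j => -deriv x (-s) j.succ) = F := fun s => by
    rw [SplitGeodesic.splitIntegral_reverse, hF]
  have hFrevneg : ∀ s, splitIntegral (-a 0) (fun j => a j.succ) (-x (-s) 0) (- -deriv x (-s) 0)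
      (fun j => x (-s) j.succ) (fun j => -deriv x (-s) j.succ) = F := fun s => by
    rw [SplitGeodesic.splitIntegral_neg, hFrev]
  have hpass : 0 < F → CrossesNeck x ∧ PassesThrough x := fun hF0 => by
    have hy : ∀ s, deriv x s 0 ≠ 0 := fun s hs => by
      have := SplitGeodesic.splitIntegral_le hα ha_pos (x s 0) (deriv x s 0)
        (fun j => x s j.succ) (fun j => deriv x s j.succ)
      rw [hF, hs] at this
      norm_num at this
      linarith
    rcases pos_or_neg_of_continuous_of_ne_zero h.continuous_y₀ hy with hy | hy
    · obtain ⟨hb, ht, s₀, h0, hl, hr⟩ := h.passes_of_pos hα ha_pos hF hF0 hy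
      refine ⟨⟨s₀, h0, Or.inl ⟨?_, ?_⟩⟩, Or.inl ⟨hb, ht⟩⟩
      · filter_upwards [self_mem_nhdsWithin] with s hs using hl s hs
      · filter_upwards [self_mem_nhdsWithin] with s hs using hr s hs
    · obtain ⟨hb, ht, s₀, h0, hl, hr⟩ := h.neg.passes_of_pos hα ha_pos hFneg hF0
        fun s => neg_pos.2 (hy s)
      refine ⟨⟨s₀, neg_eq_zero.1 h0, Or.inr ⟨?_, ?_⟩⟩,
        Or.inr ⟨tendsto_neg_atBot_iff.1 hb, tendsto_neg_atTop_iff.1 ht⟩⟩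
      · filter_upwards [self_mem_nhdsWithin] with s hs using neg_lt_zero.1 (hl s hs)
      · filter_upwards [self_mem_nhdsWithin] with s hs using neg_pos.1 (hr s hs)
  have hnonneg : ∀ {s}, x s 0 = 0 → 0 ≤ F := fun {s} hs =>
    hF s ▸ h.splitIntegral_nonneg_of_eq_zero hα ha_pos hs
  refine ⟨F, fun s => by rw [uhlenbeckDevaney_eq_splitIntegral, hF], ⟨?_, fun h0 => (hpass h0).1⟩,
    fun h0 => (hpass h0).2, fun hF0 => ?_, fun hF0 => ?_⟩
  -- A point on the neck gives F ≥ 0, and F = 0 would keep the whole curve on the neck.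
  · rintro ⟨s₀, hs₀, hside⟩
    refine lt_of_le_of_ne (hnonneg hs₀) fun h0 => ?_
    have hzero : ∀ s, x s 0 = 0 := h.eq_zero_of_zero hα ha_pos (fun s => h0 ▸ hF s) hs₀
    rcases hside with ⟨hl, -⟩ | ⟨hl, -⟩
    · obtain ⟨s, hs⟩ := hl.exists
      exact hs.ne (hzero s)
    · obtain ⟨s, hs⟩ := hl.exists
      exact hs.ne' (hzero s)
  · have hne : ∀ s, x s 0 ≠ 0 := fun s hs => absurd (hnonneg hs) (not_le.2 hF0)
    rcases pos_or_neg_of_continuous_of_ne_zero h.continuous_x₀ hne with hp | hp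
    · refine Or.inl ⟨hp, ?_, h.tendsto_atTop_of_neg hα ha_pos hF hF0 hp⟩
      have := (h.reverse.tendsto_atTop_of_neg hα ha_pos hFrev hF0 fun s => hp (-s)).comp
        tendsto_neg_atBot_atTop
      simpa [Function.comp_def] using this
    · refine Or.inr ⟨hp, ?_, ?_⟩
      · have := (h.reverse.neg.tendsto_atTop_of_neg hα ha_pos hFrevneg hF0
          fun s => neg_pos.2 (hp (-s))).comp tendsto_neg_atBot_atTop
        simp only [Function.comp_def, neg_neg] at this
        exact tendsto_neg_atTop_iff.1 this
      · exact tendsto_neg_atTop_iff.1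
          (h.neg.tendsto_atTop_of_neg hα ha_pos hFneg hF0 fun s => neg_pos.2 (hp s))
  · subst hF0
    by_cases hz : ∃ s₀, x s₀ 0 = 0
    · obtain ⟨s₀, hs₀⟩ := hz
      exact Or.inl (hx.isNeckGeodesic (h.eq_zero_of_zero hα ha_pos hF hs₀))
    push Not at hz
    have hy : ∀ s, deriv x s 0 ≠ 0 := fun s => h.y₀_ne_zero_of_zero hα ha_pos (hF s) (hz s)
    -- Equal signs of x₀ and y₀ mean motion away from the neck and call for time reversal; x₀ < 0
    -- calls for reflection.
    rcases pos_or_neg_of_continuous_of_ne_zero h.continuous_x₀ hz with hp | hp <;>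
      rcases pos_or_neg_of_continuous_of_ne_zero h.continuous_y₀ hy with hq | hq
    · have hq' : ∀ s, -deriv x (-s) 0 < 0 := fun s => neg_neg_iff_pos.2 (hq _)
      refine Or.inr (Or.inr ⟨?_, approachesNeckGeodesic_of_split ha_neg ha_pos
        (z := fun s => x (-s)) h.reverse hFrev (fun s => hp _) hq' fun s => rfl⟩)
      have := (h.reverse.tendsto_atBot_of_zero hα ha_pos hFrev (fun s => hp _) hq').comp
        tendsto_neg_atTop_atBot
      simp only [Function.comp_def, neg_neg] at this
      exact tendsto_abs_atTop_atTop.comp this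
    · exact Or.inr (Or.inl ⟨tendsto_abs_atTop_atTop.comp
        (h.tendsto_atBot_of_zero hα ha_pos hF hp hq),
        approachesNeckGeodesic_of_split ha_neg ha_pos h hF hp hq fun s => rfl⟩)
    · have hp' : ∀ s, 0 < -x s 0 := fun s => neg_pos.2 (hp s)
      have hq' : ∀ s, -deriv x s 0 < 0 := fun s => neg_neg_iff_pos.2 (hq s)
      refine Or.inr (Or.inl ⟨?_, approachesNeckGeodesic_of_split ha_neg ha_pos
        h.neg hFneg hp' hq' fun s => (abs_neg _).symm⟩)
      have := tendsto_abs_atTop_atTop.comp (h.neg.tendsto_atBot_of_zero hα ha_pos hFneg hp' hq')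
      simpa only [Function.comp_def, abs_neg] using this
    · have hp' : ∀ s, 0 < -x (-s) 0 := fun s => neg_pos.2 (hp _)
      have hq' : ∀ s, - -deriv x (-s) 0 < 0 := fun s => by rw [neg_neg]; exact hq _
      refine Or.inr (Or.inr ⟨?_, approachesNeckGeodesic_of_split ha_neg ha_pos
        (z := fun s => x (-s)) h.reverse.neg hFrevneg hp' hq' fun s => (abs_neg _).symm⟩)
      have := (tendsto_abs_atTop_atTop.comp (h.reverse.neg.tendsto_atBot_of_zero hα ha_pos
        hFrevneg hp' hq')).comp tendsto_neg_atTop_atBot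
      simpa only [Function.comp_def, abs_neg, neg_neg] using this
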